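/- **Setting.** Let $d\ge 1$, $S>0$, $\Theta=\{\theta\in\mathbb R^d:\|\theta\|\le S\}$, and let $\mathcal X\subset\mathbb R^d$ be a finite set of arms with $\|x\|\le 1$ for all $x\in\mathcal X$ that spans $\mathbb R^d$. Let $\mu(z)=1/(1+e^{-z})$ and $\theta^*\in\Theta$. In each round $t\ge1$ an arm $x_t\in\mathcal X$ is selected on the basis of the past (and possibly of internal randomization), and, conditionally on the past and on $x_t$, the reward $r_t\in\{0,1\}$ is Bernoulli with parameter $\mu(x_t^\top\theta^*)$. Let $\mathcal I$ be a finite set of answers and $i^\star:\mathbb R^d\to\mathcal I$ an arbitrary map giving the correct answer for each parameter. Put $\mathrm{Alt}(\theta)=\{\lambda\in\Theta: i^\star(\lambda)\ne i^\star(\theta)\}$. Let $\Sigma$ be the simplex of probability vectors on $\mathcal X$, and write $\|v\|_M=\sqrt{v^\top Mv}$. Define $$H_w(\theta)=\sum_{x\in\mathcal X}w_x\,\dot\mu(x^\top\theta)\,xx^\top,\quad \psi(\theta,w)=\inf_{\lambda\in\mathrm{Alt}(\theta)}\tfrac12\|\theta-\lambda\|^2_{H_w(\theta)}\in[0,\infty],\quad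 T^\star(\theta)=\Big(\max_{w\in\Sigma}\psi(\theta,w)\Big)^{-1}\in[0,\infty],$$ with $\inf\emptyset=\infty$, $1/0=\infty$, $1/\infty=0$, and let $C^\star(\theta)=\arg\max_{w\in\Sigma}\psi(\theta,w)$. Put $\kappa_0=\max_{x\in\mathcal X}1/\dot\mu(x^\top\theta^*)$ and $$A_t=\sum_{s\le t}x_sx_s^\top,\qquad H_t(\theta)=\sum_{s\le t}\dot\mu(x_s^\top\theta)x_sx_s^\top,\qquad g_t(\theta)=\sum_{s\le t}\mu(x_s^\top\theta)x_s,$$ and let $N_x(t)$ be the number of rounds up to $t$ in which $x$ was selected. **Log-TS.** Let $\hat\theta_t$ be a maximizer over $\mathbb R^d$ of the log-likelihood $\sum_{s\le t}\big(r_s\log\mu(x_s^\top\theta)+(1-r_s)\log(1-\mu(x_s^\top\theta))\big)$ (arbitrary at times when there is none). Let $\theta^{(1)}_t\in\Theta$ be a minimizer over $\theta\in\Theta$ of $\|g_t(\theta)-g_t(\hat\theta_t)\|_{H_t(\theta)^{-1}}$ (an arbitrary point of $\Theta$ at times when $A_t$ is singular or no maximizer of the likelihood exists). Let $w(t)\in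 C^\star(\theta^{(1)}_t)$. Fix $x_0(1),\dots,x_0(d)\in\mathcal X$ with $\lambda_{\min}\big(\sum_i x_0(i)x_0(i)^\top\big)>0$ and put $f(t)=\sqrt{t/d}\;\lambda_{\min}\big(\sum_i x_0(i)x_0(i)^\top\big)$. *Sampling rule.* If $\lambda_{\min}(A_t)<f(t)$, then $x_{t+1}$ is the next arm in the cyclic order $x_0(1),\dots,x_0(d),x_0(1),\dots$, the $k$-th forced exploration using the $k$-th entry of this order. Otherwise, for $t\ge1$, $$x_{t+1}\in\arg\min\Big\{N_x(t)-\sum_{s=1}^t w_x(s)\;:\;x\in\mathcal X,\ \sum_{s=1}^t w_x(s)>0\Big\}.$$ The first arm $x_1$ is arbitrary. All choices and ties are resolved arbitrarily. *Stopping rule.* Fix $c>0$ and $L>0$ (for instance $L=1/4$, the Lipschitz constant of $\mu$), let $\lambda(t)=c\log t$, and $$\gamma_t(\delta)=\frac{\sqrt{\lambda(t)}}2+\frac4{\sqrt{\lambda(t)}}\log\Big(\frac{2^d}{\delta}\Big(\frac{Lt}{\lambda(t)d}\Big)^{d/2}\Big),\qquad \beta(\delta,t)=2\big((1+2S)\gamma_t(\delta)\big)^2,$$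 with $\beta(\delta,1)=\infty$. Put $Z(t)=\inf_{\lambda\in\mathrm{Alt}(\theta^{(1)}_t)}\tfrac12\|\theta^{(1)}_t-\lambda\|^2_{H_t(\theta^{(1)}_t)}$, $B=\{t\ge1:\lambda_{\min}(A_s)>\kappa_0\lambda(s)\ \text{for all } s\ge t\}$, and $$\tau_\delta=\inf\{t\ge1:\ t\in B,\ Z(t)>\beta(\delta,t)\}\in\mathbb N\cup\{\infty\}.$$ **Theorem.** Almost surely, $$\limsup_{\delta\to0^+}\frac{\tau_\delta}{(\log(1/\delta))^2}\le T^\star(\theta^*).$$ -/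

import Mathlib

open MeasureTheory ProbabilityTheory Filter Topology
open scoped ENNReal Matrix

noncomputable section

namespace LogTS

/-- The ambient space `ℝ^d` with its Euclidean norm. -/
abbrev E (d : ℕ) : Type := EuclideanSpace ℝ (Fin d)

/-- The rank-one matrix `x xᵀ`. -/
def outer {d : ℕ} (x : E d) : Matrix (Fin d) (Fin d) ℝ := Matrix.vecMulVec x.ofLp x.ofLp

/-- `xᵀ M x`, the square of the weighted norm `‖x‖_M`. -/
def sqNorm {d : ℕ} (M : Matrix (Fin d) (Fin d) ℝ) (x : E d) : ℝ := x.ofLp ⬝ᵥ (M *ᵥ x.ofLp)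

/-- The weighted norm `‖x‖_M = √(xᵀ M x)`. -/
def wNorm {d : ℕ} (M : Matrix (Fin d) (Fin d) ℝ) (x : E d) : ℝ := √(sqNorm M x)

/-- The smallest eigenvalue of a (symmetric) matrix. -/
def lambdaMin {d : ℕ} (M : Matrix (Fin d) (Fin d) ℝ) : ℝ := sInf (spectrum ℝ M)

/-- The parameter set `Θ = {θ : ‖θ‖ ≤ S}`. -/
def Theta (d : ℕ) (S : ℝ) : Set (E d) := {θ | ‖θ‖ ≤ S}

/-! ### The logistic model.  `Real.sigmoid z = (1 + exp (-z))⁻¹` is the logistic function. -/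

/-- The derivative of the logistic function. -/
def dmu (z : ℝ) : ℝ := deriv Real.sigmoid z

/-- `κ₀ = sup_{x ∈ 𝒳} 1 / μ'(xᵀ θ)`. -/
def kappa {d : ℕ} (𝒳 : Finset (E d)) (θ : E d) : ℝ :=
  ⨆ a : 𝒳, 1 / dmu (inner ℝ (a : E d) θ)

/-- `H_w(θ) = ∑_{x ∈ 𝒳} w_x μ'(xᵀ θ) x xᵀ`. -/
def HW {d : ℕ} (𝒳 : Finset (E d)) (w : 𝒳 → ℝ) (θ : E d) : Matrix (Fin d) (Fin d) ℝ :=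
  ∑ a : 𝒳, (w a * dmu (inner ℝ (a : E d) θ)) • outer (a : E d)

/-! ### The pure exploration problem.  `istar θ` is the correct answer for the parameter `θ`. -/

/-- `Alt(θ)`, the parameters in `Θ` whose correct answer differs from that of `θ`. -/
def Alt {d : ℕ} {I : Type*} (S : ℝ) (istar : E d → I) (θ : E d) : Set (E d) :=
  {lam | lam ∈ Theta d S ∧ istar lam ≠ istar θ}

/-- `ψ(θ, w) = inf_{λ ∈ Alt(θ)} ½ ‖θ - λ‖²_{H_w(θ)}`, with value `∞` if `Alt(θ)` is empty. -/
def psi {d : ℕ} {I : Type*} (𝒳 : Finset (E d)) (S : ℝ) (istar : E d → I) (θ : E d)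
    (w : 𝒳 → ℝ) : ℝ≥0∞ :=
  ⨅ lam ∈ Alt S istar θ, ENNReal.ofReal (1 / 2 * sqNorm (HW 𝒳 w θ) (θ - lam))

/-- `ψ*(θ)`, the maximum over the simplex of `ψ(θ, ·)`. -/
def psiStar {d : ℕ} {I : Type*} (𝒳 : Finset (E d)) (S : ℝ) (istar : E d → I) (θ : E d) : ℝ≥0∞ :=
  ⨆ w ∈ stdSimplex ℝ 𝒳, psi 𝒳 S istar θ w

/-- The characteristic time `T*(θ)`, given by `T*(θ)⁻¹ = ψ*(θ)` (so it is `∞` if `ψ*(θ) = 0`). -/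
def TStar {d : ℕ} {I : Type*} (𝒳 : Finset (E d)) (S : ℝ) (istar : E d → I) (θ : E d) : ℝ≥0∞ :=
  (psiStar 𝒳 S istar θ)⁻¹

/-- `C*(θ)`, the set of maximizers of `ψ(θ, ·)` over the simplex. -/
def CStar {d : ℕ} {I : Type*} (𝒳 : Finset (E d)) (S : ℝ) (istar : E d → I) (θ : E d) :
    Set (𝒳 → ℝ) :=
  {w | w ∈ stdSimplex ℝ 𝒳 ∧ ∀ v ∈ stdSimplex ℝ 𝒳, psi 𝒳 S istar θ v ≤ psi 𝒳 S istar θ w}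

/-! ### Quantities computed from a trajectory.
`x s` and `r s` are the arm and the reward of round `s = 1, 2, …`; the entries at `0` are unused. -/

/-- The design matrix `A_t`. -/
def design {d : ℕ} {𝒳 : Finset (E d)} (x : ℕ → 𝒳) (t : ℕ) : Matrix (Fin d) (Fin d) ℝ :=
  ∑ s ∈ Finset.Icc 1 t, outer (x s : E d)

/-- The Fisher information matrix `H_t(θ)`. -/
def fisher {d : ℕ} {𝒳 : Finset (E d)} (x : ℕ → 𝒳) (t : ℕ) (θ : E d) :
    Matrix (Fin d) (Fin d) ℝ :=
  ∑ s ∈ Finset.Icc 1 t, dmu (inner ℝ (x s : E d) θ) • outer (x s : E d)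

/-- `g_t(θ) = ∑_{s ≤ t} μ(x_sᵀ θ) x_s`. -/
def gvec {d : ℕ} {𝒳 : Finset (E d)} (x : ℕ → 𝒳) (t : ℕ) (θ : E d) : E d :=
  ∑ s ∈ Finset.Icc 1 t, Real.sigmoid (inner ℝ (x s : E d) θ) • (x s : E d)

/-- The log-likelihood at time `t`. -/
def logLik {d : ℕ} {𝒳 : Finset (E d)} (x : ℕ → 𝒳) (r : ℕ → ℝ) (t : ℕ) (θ : E d) : ℝ :=
  ∑ s ∈ Finset.Icc 1 t,
    (r s * Real.log (Real.sigmoid (inner ℝ (x s : E d) θ))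
      + (1 - r s) * Real.log (1 - Real.sigmoid (inner ℝ (x s : E d) θ)))

/-- `θ` is a maximum likelihood estimate at time `t`: a global maximizer over `ℝ^d`. -/
def IsMLE {d : ℕ} {𝒳 : Finset (E d)} (x : ℕ → 𝒳) (r : ℕ → ℝ) (t : ℕ) (θ : E d) : Prop :=
  ∀ θ' : E d, logLik x r t θ' ≤ logLik x r t θ

open Classical in
/-- `N_a(t)`, the number of rounds up to `t` in which arm `a` was selected. -/
def pulls {d : ℕ} {𝒳 : Finset (E d)} (x : ℕ → 𝒳) (t : ℕ) (a : 𝒳) : ℕ :=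
  ((Finset.Icc 1 t).filter (fun s => x s = a)).card

/-- The cumulated weights `∑_{s ≤ t} w_a(s)`. -/
def cumWeight {d : ℕ} {𝒳 : Finset (E d)} (w : ℕ → 𝒳 → ℝ) (t : ℕ) (a : 𝒳) : ℝ :=
  ∑ s ∈ Finset.Icc 1 t, w s a

/-! ### Sampling rule -/

/-- `c_{𝒳₀} = λ_min(∑_{x ∈ 𝒳₀} x xᵀ) / √d` for `𝒳₀ = {x0 0, …, x0 (d-1)}`. -/
def cX0 {d : ℕ} {𝒳 : Finset (E d)} (x0 : Fin d → 𝒳) : ℝ :=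
  1 / √(d : ℝ) * lambdaMin (∑ i, outer (x0 i : E d))

/-- After round `t` the next round is a forced exploration: `λ_min(A_t) < f(t) = c_{𝒳₀} √t`. -/
def Forced {d : ℕ} {𝒳 : Finset (E d)} (x0 : Fin d → 𝒳) (x : ℕ → 𝒳) (t : ℕ) : Prop :=
  lambdaMin (design x t) < cX0 x0 * √(t : ℝ)

open Classical in
/-- The round-robin index: it starts at the first arm of `𝒳₀` and moves on cyclically
(addition in `Fin d` is modulo `d`) after each forced exploration. -/
def rrIndex {d : ℕ} [NeZero d] {𝒳 : Finset (E d)} (x0 : Fin d → 𝒳) (x : ℕ → 𝒳) : ℕ → Fin d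
  | 0 => 0
  | t + 1 => if Forced x0 x t then rrIndex x0 x t + 1 else rrIndex x0 x t

/-- The trajectory `(x, r)`, with estimates `θhat`, projected estimates `θproj` and weights `w`,
follows the Log-TS sampling rule.  Ties and choices among several maximizers or minimizers are
arbitrary; the estimate is arbitrary at the times when no maximum likelihood estimate exists, and
then, or when `A_t` is singular, the projected estimate is an arbitrary point of `Θ`; the first arm
is arbitrary, since there `λ_min(A_0) = 0 = f(0)` and no weights are available yet. -/
structure IsRun {d : ℕ} [NeZero d] {I : Type*} (𝒳 : Finset (E d)) (S : ℝ) (istar : E d → I)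
    (x0 : Fin d → 𝒳) (x : ℕ → 𝒳) (r : ℕ → ℝ) (θhat θproj : ℕ → E d) (w : ℕ → 𝒳 → ℝ) : Prop where
  mle : ∀ t, 1 ≤ t → (∃ θ, IsMLE x r t θ) → IsMLE x r t (θhat t)
  proj_mem : ∀ t, 1 ≤ t → θproj t ∈ Theta d S
  proj_min : ∀ t, 1 ≤ t → (∃ θ, IsMLE x r t θ) → (design x t).PosDef → ∀ θ ∈ Theta d S,
    wNorm (fisher x t (θproj t))⁻¹ (gvec x t (θproj t) - gvec x t (θhat t))
      ≤ wNorm (fisher x t θ)⁻¹ (gvec x t θ - gvec x t (θhat t))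
  weights : ∀ t, 1 ≤ t → w t ∈ CStar 𝒳 S istar (θproj t)
  forced : ∀ t, Forced x0 x t → x (t + 1) = x0 (rrIndex x0 x t)
  tracking : ∀ t, 1 ≤ t → ¬ Forced x0 x t →
    0 < cumWeight w t (x (t + 1)) ∧
    ∀ a : 𝒳, 0 < cumWeight w t a →
      (pulls x t (x (t + 1)) : ℝ) - cumWeight w t (x (t + 1)) ≤ (pulls x t a : ℝ) - cumWeight w t a

/-! ### Stopping rule -/

/-- `γ_t(δ)`, for the regularization level `l = λ(t)`. -/
def gammaT (d : ℕ) (L l : ℝ) (t : ℕ) (δ : ℝ) : ℝ :=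
  √l / 2 + 4 / √l * Real.log (2 ^ d / δ * (L * t / (l * d)) ^ ((d : ℝ) / 2))

/-- The threshold `β(δ, t) = 2 ((1 + 2S) γ_t(δ))²`, for `l = λ(t)`; it is infinite when `l = 0`. -/
def beta (d : ℕ) (S L l : ℝ) (δ : ℝ) (t : ℕ) : ℝ≥0∞ :=
  if 0 < l then ENNReal.ofReal (2 * ((1 + 2 * S) * gammaT d L l t δ) ^ 2) else ⊤

/-- `B = {t ≥ 1 : λ_min(A_s) > κ₀ λ(s) for all s ≥ t}`. -/
def B {d : ℕ} {𝒳 : Finset (E d)} (θ : E d) (lam : ℕ → ℝ) (x : ℕ → 𝒳) : Set ℕ :=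
  {t | 1 ≤ t ∧ ∀ s, t ≤ s → kappa 𝒳 θ * lam s < lambdaMin (design x s)}

/-- `Z(t) = inf_{λ ∈ Alt(θproj_t)} ½ ‖θproj_t - λ‖²_{H_t(θproj_t)}`. -/
def Z {d : ℕ} {I : Type*} {𝒳 : Finset (E d)} (S : ℝ) (istar : E d → I) (x : ℕ → 𝒳)
    (θproj : ℕ → E d) (t : ℕ) : ℝ≥0∞ :=
  ⨅ lam ∈ Alt S istar (θproj t),
    ENNReal.ofReal (1 / 2 * sqNorm (fisher x t (θproj t)) (θproj t - lam))

/-- The stopping time `τ_δ = inf {t ≥ 1 : Z(t) > β(δ, t), t ∈ B}`, with `inf ∅ = ∞`. -/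
def tau {d : ℕ} {I : Type*} {𝒳 : Finset (E d)} (S L : ℝ) (istar : E d → I) (θ : E d)
    (lam : ℕ → ℝ) (x : ℕ → 𝒳) (θproj : ℕ → E d) (δ : ℝ) : ℕ∞ :=
  ⨅ t ∈ {t : ℕ | 1 ≤ t ∧ beta d S L (lam t) δ t < Z S istar x θproj t ∧ t ∈ B θ lam x}, (t : ℕ∞)

/-! ### The stochastic environment -/

/-- Logistic bandit interaction: the arm of round `t + 1` is chosen from the information `ℱ t`
available after round `t` (which may include internal randomization), and given `ℱ t` the reward of
round `t + 1` is Bernoulli with parameter `μ(x_{t+1}ᵀ θ)`. -/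
structure IsLogisticBandit {d : ℕ} {Ω : Type*} {mΩ : MeasurableSpace Ω} (P : Measure Ω)
    (ℱ : Filtration ℕ mΩ) (𝒳 : Finset (E d)) (θ : E d) (x : ℕ → Ω → 𝒳) (r : ℕ → Ω → ℝ) :
    Prop where
  arm_meas : ∀ t, Measurable[ℱ t] (x (t + 1))
  reward_meas : ∀ t, Measurable[ℱ (t + 1)] (r (t + 1))
  reward_binary : ∀ t ω, r (t + 1) ω = 0 ∨ r (t + 1) ω = 1
  reward_law : ∀ t,
    P[r (t + 1) | ℱ t] =ᵐ[P] fun ω => Real.sigmoid (inner ℝ (x (t + 1) ω : E d) θ)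

end LogTS

end

namespace LogTS

/-! ### Quadratic forms and smallest eigenvalues -/

/-! If `ψ*(θ*) = 0` the bound is `∞`. Otherwise the limsup is in fact `0`: the threshold is of order
`log(1/δ)² / λ(t)` up to lower-order terms, and `λ(t) = c log t` tends to infinity, so at times `t ≈
ε log(1/δ)²` it is `o(t)` for every fixed `ε > 0` (`eventually_beta_lt`). It therefore suffices that
almost surely `Z(t) ≥ k t` eventually for some `k > 0` (`IsRun.eventually_le_Z`) and that every late
time lies in `B` (`IsRun.eventually_mem_B`). `limsup_tau_eq_zero` then stops at `⌊ε log(1/δ)²⌋` and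
lets `ε` shrink.

Linear growth of `Z` rests on consistency of the projected estimate. Forced exploration keeps
`λ_min(A_t)` above a multiple of `√t` (`half_cX0_mul_sqrt_le_lambdaMin`) while using only `O(√t)`
rounds (`forcedCount_le`). The noise of each arm is controlled by an exponential supermartingale and
Borel-Cantelli (`IsLogisticBandit.ae_eventually_abs_noise_le`). This makes the score at `θ*`
negligible against `√λ_min(A_t)` in the dual norm of `A_t`, so the likelihood has a maximizer and
the projection converges to `θ*` (`IsRun.tendsto_proj`). Positivity of `ψ*(θ*)` separates `θ*` from
its alternatives, so late weights all have cost bounded below against every alternative, and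
tracking carries this over to the actual pulls up to `O(√t)`.

Probability enters only through the noise bound; the rest is deterministic along a trajectory. -/

lemma inner_eq_dotProduct {d : ℕ} (x y : E d) : inner ℝ x y = x.ofLp ⬝ᵥ y.ofLp := by
  rw [EuclideanSpace.inner_eq_star_dotProduct, dotProduct_comm]
  rfl

lemma outer_mulVec {d : ℕ} (x v : E d) :
    outer x *ᵥ v.ofLp = (inner ℝ x v : ℝ) • x.ofLp := by
  rw [outer, Matrix.vecMulVec_mulVec, inner_eq_dotProduct]
  ext i
  simp [mul_comm]

lemma weighted_mulVec {d : ℕ} {ι : Type*} (s : Finset ι) (c : ι → ℝ) (y : ι → E d) (v : E d) :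
    (∑ i ∈ s, c i • outer (y i)) *ᵥ v.ofLp
      = ∑ i ∈ s, (c i * inner ℝ (y i) v) • (y i).ofLp := by
  rw [Matrix.sum_mulVec]
  refine Finset.sum_congr rfl fun i _ => ?_
  rw [Matrix.smul_mulVec, outer_mulVec, smul_smul]

lemma weighted_bilin {d : ℕ} {ι : Type*} (s : Finset ι) (c : ι → ℝ) (y : ι → E d) (u v : E d) :
    u.ofLp ⬝ᵥ ((∑ i ∈ s, c i • outer (y i)) *ᵥ v.ofLp)
      = ∑ i ∈ s, c i * inner ℝ (y i) v * inner ℝ (y i) u := by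
  rw [weighted_mulVec, dotProduct_sum]
  refine Finset.sum_congr rfl fun i _ => ?_
  rw [dotProduct_smul, smul_eq_mul, inner_eq_dotProduct (y i) u, dotProduct_comm u.ofLp]

lemma sqNorm_weighted {d : ℕ} {ι : Type*} (s : Finset ι) (c : ι → ℝ) (y : ι → E d) (v : E d) :
    sqNorm (∑ i ∈ s, c i • outer (y i)) v = ∑ i ∈ s, c i * (inner ℝ (y i) v : ℝ) ^ 2 := by
  rw [sqNorm, weighted_bilin]
  exact Finset.sum_congr rfl fun i _ => by ring

lemma sqNorm_sum_outer {d : ℕ} {ι : Type*} (s : Finset ι) (y : ι → E d) (v : E d) :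
    sqNorm (∑ i ∈ s, outer (y i)) v = ∑ i ∈ s, (inner ℝ (y i) v : ℝ) ^ 2 := by
  simpa using sqNorm_weighted s (fun _ => 1) y v

lemma sqNorm_design {d : ℕ} {𝒳 : Finset (E d)} (x : ℕ → 𝒳) (t : ℕ) (v : E d) :
    sqNorm (design x t) v = ∑ s ∈ Finset.Icc 1 t, (inner ℝ (x s : E d) v : ℝ) ^ 2 :=
  sqNorm_sum_outer _ _ _

lemma sqNorm_fisher {d : ℕ} {𝒳 : Finset (E d)} (x : ℕ → 𝒳) (t : ℕ) (θ v : E d) :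
    sqNorm (fisher x t θ) v
      = ∑ s ∈ Finset.Icc 1 t, dmu (inner ℝ (x s : E d) θ) * (inner ℝ (x s : E d) v : ℝ) ^ 2 :=
  sqNorm_weighted _ (fun s => dmu (inner ℝ (x s : E d) θ)) _ _

lemma sqNorm_HW {d : ℕ} (𝒳 : Finset (E d)) (w : 𝒳 → ℝ) (θ v : E d) :
    sqNorm (HW 𝒳 w θ) v
      = ∑ a : 𝒳, w a * (dmu (inner ℝ (a : E d) θ) * (inner ℝ (a : E d) v : ℝ) ^ 2) := by
  rw [HW, sqNorm_weighted]
  exact Finset.sum_congr rfl fun i _ => by ring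

lemma isHermitian_outer {d : ℕ} (x : E d) : (outer x).IsHermitian := by
  ext i j
  simp [outer, Matrix.vecMulVec_apply, mul_comm]

lemma isHermitian_weighted {d : ℕ} {ι : Type*} (s : Finset ι) (c : ι → ℝ) (y : ι → E d) :
    (∑ i ∈ s, c i • outer (y i)).IsHermitian := by
  unfold Matrix.IsHermitian
  rw [Matrix.conjTranspose_sum]
  refine Finset.sum_congr rfl fun i _ => ?_
  rw [Matrix.conjTranspose_smul, (isHermitian_outer (y i)).eq, star_trivial]

lemma isHermitian_sum_outer {d : ℕ} {ι : Type*} (s : Finset ι) (y : ι → E d) :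
    (∑ i ∈ s, outer (y i)).IsHermitian := by
  simpa using isHermitian_weighted s (fun _ => 1) y

lemma dotProduct_self_eq_norm_sq {d : ℕ} (v : E d) : v.ofLp ⬝ᵥ v.ofLp = ‖v‖ ^ 2 := by
  rw [← inner_eq_dotProduct, real_inner_self_eq_norm_sq]

/-- Subtracting `m` times the identity shifts the spectrum by `m`, and both sides then say that the
shifted matrix is positive semidefinite. -/
lemma forall_spectrum_ge_iff {d : ℕ} {M : Matrix (Fin d) (Fin d) ℝ} (hM : M.IsHermitian) (m : ℝ) :
    (∀ l ∈ spectrum ℝ M, m ≤ l) ↔ ∀ v : E d, m * ‖v‖ ^ 2 ≤ sqNorm M v := by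
  have hH : (M - algebraMap ℝ _ m).IsHermitian := by
    refine hM.sub ?_
    rw [Algebra.algebraMap_eq_smul_one]
    unfold Matrix.IsHermitian
    simp
  have key := Matrix.posSemidef_iff_isHermitian_and_spectrum_nonneg (A := M - algebraMap ℝ _ m)
  have hq : ∀ v : E d, v.ofLp ⬝ᵥ ((M - algebraMap ℝ _ m) *ᵥ v.ofLp)
      = sqNorm M v - m * ‖v‖ ^ 2 := by
    intro v
    rw [Matrix.sub_mulVec, dotProduct_sub, Algebra.algebraMap_eq_smul_one, Matrix.smul_mulVec,
      Matrix.one_mulVec, dotProduct_smul, dotProduct_self_eq_norm_sq]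
    rfl
  rw [← spectrum.sub_singleton_eq] at key
  constructor
  · intro h v
    have : (M - algebraMap ℝ _ m).PosSemidef := by
      refine key.2 ⟨hH, ?_⟩
      rintro _ ⟨l, hl, _, rfl, rfl⟩
      exact sub_nonneg.2 (h l hl)
    have h2 := this.dotProduct_mulVec_nonneg v.ofLp
    rw [star_trivial, hq] at h2
    linarith
  · intro h l hl
    have : (M - algebraMap ℝ _ m).PosSemidef := by
      refine Matrix.PosSemidef.of_dotProduct_mulVec_nonneg hH fun v => ?_
      have := hq (WithLp.toLp 2 v)
      have h2 := h (WithLp.toLp 2 v)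
      rw [star_trivial]
      simp only at this
      linarith
    have h2 := (key.1 this).2 ⟨l, hl, m, rfl, rfl⟩
    exact sub_nonneg.1 h2

/-- Without this, `sInf ∅ = 0` would break the passage from a lower bound on the quadratic form to
one on `lambdaMin`. -/
lemma spectrum_nonempty {d : ℕ} [NeZero d] {M : Matrix (Fin d) (Fin d) ℝ} (hM : M.IsHermitian) :
    (spectrum ℝ M).Nonempty := by
  rw [hM.spectrum_real_eq_range_eigenvalues]
  exact Set.range_nonempty _

lemma le_lambdaMin {d : ℕ} [NeZero d] {M : Matrix (Fin d) (Fin d) ℝ} (hM : M.IsHermitian) {m : ℝ}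
    (h : ∀ v : E d, m * ‖v‖ ^ 2 ≤ sqNorm M v) : m ≤ lambdaMin M :=
  le_csInf (spectrum_nonempty hM) ((forall_spectrum_ge_iff hM m).2 h)

lemma lambdaMin_mul_le {d : ℕ} {M : Matrix (Fin d) (Fin d) ℝ} (hM : M.IsHermitian)
    (v : E d) : lambdaMin M * ‖v‖ ^ 2 ≤ sqNorm M v := by
  refine (forall_spectrum_ge_iff hM _).1 (fun l hl => csInf_le ?_ hl) v
  rw [hM.spectrum_real_eq_range_eigenvalues]
  exact (Set.finite_range _).bddBelow

lemma lambdaMin_design_mul_le {d : ℕ} {𝒳 : Finset (E d)} (x : ℕ → 𝒳) (t : ℕ) (v : E d) :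
    lambdaMin (design x t) * ‖v‖ ^ 2 ≤ ∑ s ∈ Finset.Icc 1 t, (inner ℝ (x s : E d) v : ℝ) ^ 2 := by
  rw [← sqNorm_design]
  exact lambdaMin_mul_le (isHermitian_sum_outer _ _) v

lemma le_lambdaMin_design {d : ℕ} [NeZero d] {𝒳 : Finset (E d)} (x : ℕ → 𝒳) (t : ℕ) {m : ℝ}
    (h : ∀ v : E d, m * ‖v‖ ^ 2 ≤ ∑ s ∈ Finset.Icc 1 t, (inner ℝ (x s : E d) v : ℝ) ^ 2) :
    m ≤ lambdaMin (design x t) :=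
  le_lambdaMin (isHermitian_sum_outer _ _) fun v => (h v).trans_eq (sqNorm_design x t v).symm

lemma posDef_of_le_sqNorm {d : ℕ} {M : Matrix (Fin d) (Fin d) ℝ} (hM : M.IsHermitian) {m : ℝ}
    (hm : 0 < m) (h : ∀ v : E d, m * ‖v‖ ^ 2 ≤ sqNorm M v) : M.PosDef := by
  refine Matrix.PosDef.of_dotProduct_mulVec_pos hM fun v hv => ?_
  have h2 := h (WithLp.toLp 2 v)
  have : 0 < ‖WithLp.toLp 2 v‖ := by
    rw [norm_pos_iff]
    simpa using hv
  rw [star_trivial]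
  exact lt_of_lt_of_le (by positivity) h2

/-- With `u = M⁻¹ y`: the dual norm is `‖y‖²_{M⁻¹} = ⟨u, y⟩ = ‖u‖²_M`, and Cauchy-Schwarz holds. -/
lemma exists_dual_weighted {d : ℕ} {ι : Type*} (s : Finset ι) (c : ι → ℝ) (z : ι → E d)
    (hc : ∀ i ∈ s, 0 ≤ c i) (hM : (∑ i ∈ s, c i • outer (z i)).PosDef) (y : E d) :
    ∃ u : E d, wNorm (∑ i ∈ s, c i • outer (z i))⁻¹ y ^ 2 = inner ℝ u y ∧
      wNorm (∑ i ∈ s, c i • outer (z i))⁻¹ y ^ 2 = ∑ i ∈ s, c i * (inner ℝ (z i) u : ℝ) ^ 2 ∧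
      ∀ v : E d, (inner ℝ v y : ℝ) ≤ √(∑ i ∈ s, c i * (inner ℝ (z i) v : ℝ) ^ 2)
        * wNorm (∑ i ∈ s, c i • outer (z i))⁻¹ y := by
  set M := ∑ i ∈ s, c i • outer (z i) with hMdef
  set u : E d := WithLp.toLp 2 (M⁻¹ *ᵥ y.ofLp) with hu
  have hdet : IsUnit M.det := (Matrix.isUnit_iff_isUnit_det _).1 hM.isUnit
  have hMu : M *ᵥ u.ofLp = y.ofLp := by
    simp only [hu, Matrix.mulVec_mulVec, Matrix.mul_nonsing_inv _ hdet, Matrix.one_mulVec]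
  have hb : ∀ v : E d, (inner ℝ v y : ℝ)
      = ∑ i ∈ s, c i * inner ℝ (z i) u * inner ℝ (z i) v := by
    intro v
    rw [inner_eq_dotProduct, ← hMu, hMdef, weighted_bilin]
  have h1 : sqNorm M⁻¹ y = inner ℝ u y := by
    rw [sqNorm, inner_eq_dotProduct, dotProduct_comm]
  have h2 : (inner ℝ u y : ℝ) = ∑ i ∈ s, c i * (inner ℝ (z i) u : ℝ) ^ 2 := by
    rw [hb]
    exact Finset.sum_congr rfl fun i _ => by ring
  have h3 : 0 ≤ sqNorm M⁻¹ y := by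
    rw [h1, h2]
    exact Finset.sum_nonneg fun i hi => mul_nonneg (hc i hi) (sq_nonneg _)
  have h4 : wNorm M⁻¹ y ^ 2 = sqNorm M⁻¹ y := Real.sq_sqrt h3
  refine ⟨u, h4.trans h1, by rw [h4, h1, h2], fun v => ?_⟩
  have h5 : wNorm M⁻¹ y = √(∑ i ∈ s, c i * (inner ℝ (z i) u : ℝ) ^ 2) := by
    rw [wNorm, h1, h2]
  rw [h5, hb, mul_comm]
  have h6 := Real.sum_mul_le_sqrt_mul_sqrt s (fun i => √(c i) * inner ℝ (z i) u)
    (fun i => √(c i) * inner ℝ (z i) v)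
  convert h6 using 1
  · refine Finset.sum_congr rfl fun i hi => ?_
    linear_combination (-(inner ℝ (z i) u * inner ℝ (z i) v)) * Real.mul_self_sqrt (hc i hi)
  · congr 2 <;> exact Finset.sum_congr rfl fun i hi => by rw [mul_pow, Real.sq_sqrt (hc i hi)]

/-! ### Counting pulls -/

lemma sum_comp_eq_sum_pulls {d : ℕ} {𝒳 : Finset (E d)} (x : ℕ → 𝒳) (t : ℕ) (φ : 𝒳 → ℝ) :
    ∑ s ∈ Finset.Icc 1 t, φ (x s) = ∑ a, (pulls x t a : ℝ) * φ a := by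
  classical
  rw [← Finset.sum_fiberwise (Finset.Icc 1 t) x]
  refine Finset.sum_congr rfl fun a _ => ?_
  rw [Finset.sum_congr rfl (g := fun _ => φ a)
    (fun s hs => by rw [(Finset.mem_filter.1 hs).2]), Finset.sum_const, nsmul_eq_mul, pulls]

lemma sum_pulls {d : ℕ} {𝒳 : Finset (E d)} (x : ℕ → 𝒳) (t : ℕ) :
    ∑ a, (pulls x t a : ℝ) = t := by
  have := sum_comp_eq_sum_pulls x t (fun _ => 1)
  simpa using this.symm

lemma pulls_succ {d : ℕ} {𝒳 : Finset (E d)} (x : ℕ → 𝒳) (t : ℕ) (a : 𝒳) [Decidable (x (t + 1) = a)] :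
    pulls x (t + 1) a = pulls x t a + if x (t + 1) = a then 1 else 0 := by
  classical
  unfold pulls
  rw [← Finset.insert_Icc_right_eq_Icc_add_one (by omega : 1 ≤ t + 1), Finset.filter_insert]
  split_ifs with h
  · rw [Finset.card_insert_of_notMem]
    simp
  · simp

/-! ### Forced exploration -/

open Classical in
/-- The number of forced explorations among the rounds `1, …, t`. -/
noncomputable def forcedCount {d : ℕ} {𝒳 : Finset (E d)} (x0 : Fin d → 𝒳) (x : ℕ → 𝒳) (t : ℕ) : ℕ :=
  ((Finset.range t).filter (Forced x0 x)).card

lemma forcedCount_succ_of_forced {d : ℕ} {𝒳 : Finset (E d)} {x0 : Fin d → 𝒳} {x : ℕ → 𝒳} {t : ℕ}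
    (h : Forced x0 x t) : forcedCount x0 x (t + 1) = forcedCount x0 x t + 1 := by
  classical
  unfold forcedCount
  rw [Finset.range_add_one, Finset.filter_insert, if_pos h, Finset.card_insert_of_notMem]
  simp

lemma forcedCount_succ_of_not_forced {d : ℕ} {𝒳 : Finset (E d)} {x0 : Fin d → 𝒳} {x : ℕ → 𝒳}
    {t : ℕ} (h : ¬ Forced x0 x t) : forcedCount x0 x (t + 1) = forcedCount x0 x t := by
  classical
  unfold forcedCount
  rw [Finset.range_add_one, Finset.filter_insert, if_neg h]

lemma forcedCount_le_succ {d : ℕ} {𝒳 : Finset (E d)} (x0 : Fin d → 𝒳) (x : ℕ → 𝒳) (t : ℕ) :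
    forcedCount x0 x t ≤ forcedCount x0 x (t + 1) := by
  by_cases h : Forced x0 x t
  · rw [forcedCount_succ_of_forced h]; omega
  · rw [forcedCount_succ_of_not_forced h]

lemma ofNat_succ {d : ℕ} [NeZero d] (k : ℕ) : Fin.ofNat d (k + 1) = Fin.ofNat d k + 1 := by
  ext
  simp [Fin.ofNat, Fin.val_add]

lemma ofNat_add_self {d : ℕ} [NeZero d] (k : ℕ) : Fin.ofNat d (k + d) = Fin.ofNat d k := by
  ext
  simp [Fin.ofNat]

/-- Since the index is the forced count modulo `d`, any `d` successive forced explorations run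
through all of `x0`. -/
lemma rrIndex_eq {d : ℕ} [NeZero d] {𝒳 : Finset (E d)} (x0 : Fin d → 𝒳) (x : ℕ → 𝒳) (t : ℕ) :
    rrIndex x0 x t = Fin.ofNat d (forcedCount x0 x t) := by
  induction t with
  | zero => simp [rrIndex, forcedCount]
  | succ t ih =>
    rw [rrIndex]
    split_ifs with h
    · rw [forcedCount_succ_of_forced h, ofNat_succ, ih]
    · rw [forcedCount_succ_of_not_forced h, ih]

/-- Shifting the window by one drops its first term and gains the same term `d` places later. -/
lemma sum_cycle {d : ℕ} [NeZero d] (φ : Fin d → ℝ) (a : ℕ) :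
    ∑ k ∈ Finset.range d, φ (Fin.ofNat d (a + k)) = ∑ i, φ i := by
  induction a with
  | zero =>
    rw [Finset.sum_range]
    refine Finset.sum_congr rfl fun i _ => ?_
    congr 1
    ext
    simp [Fin.ofNat, Nat.mod_eq_of_lt i.2]
  | succ a ih =>
    have h1 := Finset.sum_range_succ (fun k => φ (Fin.ofNat d (a + k))) d
    have h2 := Finset.sum_range_succ' (fun k => φ (Fin.ofNat d (a + k))) d
    rw [ofNat_add_self] at h1
    simp only [add_zero] at h2
    rw [← ih]
    have : ∀ k, a + 1 + k = a + (k + 1) := fun k => by ring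
    simp only [this]
    linarith

lemma sum_cycles {d : ℕ} [NeZero d] (φ : Fin d → ℝ) (n : ℕ) :
    ∑ k ∈ Finset.range (n * d), φ (Fin.ofNat d k) = n * ∑ i, φ i := by
  induction n with
  | zero => simp
  | succ n ih =>
    rw [Nat.succ_mul, Finset.sum_range_add, ih, sum_cycle]
    push_cast
    ring

/-- Unforced rounds only add nonnegative terms, and forced ones follow the cycle. Applied with `φ a
= ⟨a, v⟩²`, it bounds the quadratic form of the design matrix from below. -/
lemma sum_forced_le {d : ℕ} [NeZero d] {𝒳 : Finset (E d)} {x0 : Fin d → 𝒳} {x : ℕ → 𝒳}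
    (hx : ∀ t, Forced x0 x t → x (t + 1) = x0 (rrIndex x0 x t)) (φ : 𝒳 → ℝ) (hφ : ∀ a, 0 ≤ φ a)
    (s n : ℕ) :
    ∑ k ∈ Finset.Ico (forcedCount x0 x s) (forcedCount x0 x (s + n)), φ (x0 (Fin.ofNat d k))
        + ∑ j ∈ Finset.Icc 1 s, φ (x j)
      ≤ ∑ j ∈ Finset.Icc 1 (s + n), φ (x j) := by
  have hmono : ∀ n, forcedCount x0 x s ≤ forcedCount x0 x (s + n) :=
    fun n => (monotone_nat_of_le_succ (forcedCount_le_succ x0 x)) (Nat.le_add_right s n)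
  induction n with
  | zero => simp
  | succ n ih =>
    rw [← add_assoc, Finset.sum_Icc_succ_top (by omega)]
    by_cases h : Forced x0 x (s + n)
    · rw [forcedCount_succ_of_forced h, Finset.sum_Ico_succ_top (hmono n), hx _ h, rrIndex_eq]
      linarith
    · rw [forcedCount_succ_of_not_forced h]
      linarith [hφ (x (s + n + 1))]

lemma lambdaMin_x0_mul_le {d : ℕ} {𝒳 : Finset (E d)} {x0 : Fin d → 𝒳} (v : E d) :
    lambdaMin (∑ i, outer (x0 i : E d)) * ‖v‖ ^ 2 ≤ ∑ i, (inner ℝ (x0 i : E d) v : ℝ) ^ 2 := by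
  rw [← sqNorm_sum_outer]
  exact lambdaMin_mul_le (isHermitian_sum_outer _ _) v

section Growth

variable {d : ℕ} [NeZero d] {𝒳 : Finset (E d)} {x0 : Fin d → 𝒳} {x : ℕ → 𝒳}

lemma lambdaMin_design_mono {s t : ℕ} (h : s ≤ t) :
    lambdaMin (design x s) ≤ lambdaMin (design x t) := by
  refine le_lambdaMin_design x t fun v => (lambdaMin_design_mul_le x s v).trans ?_
  exact Finset.sum_le_sum_of_subset_of_nonneg (Finset.Icc_subset_Icc_right h)
    fun _ _ _ => sq_nonneg _

lemma cX0_mul_sqrt : cX0 x0 * √(d : ℝ) = lambdaMin (∑ i, outer (x0 i : E d)) := by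
  have : 0 < √(d : ℝ) := Real.sqrt_pos.2 (by exact_mod_cast Nat.pos_of_neZero d)
  rw [cX0]
  field_simp

lemma cX0_pos (h0 : 0 < lambdaMin (∑ i, outer (x0 i : E d))) : 0 < cX0 x0 := by
  have : 0 < √(d : ℝ) := Real.sqrt_pos.2 (by exact_mod_cast Nat.pos_of_neZero d)
  rw [cX0]
  positivity

lemma mul_le_lambdaMin_design (hx : ∀ t, Forced x0 x t → x (t + 1) = x0 (rrIndex x0 x t))
    (t : ℕ) :
    (forcedCount x0 x t / d : ℕ) * lambdaMin (∑ i, outer (x0 i : E d))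
      ≤ lambdaMin (design x t) := by
  refine le_lambdaMin_design x t fun v => ?_
  have h := sum_forced_le hx (fun a => (inner ℝ (a : E d) v : ℝ) ^ 2) (fun a => sq_nonneg _) 0 t
  simp only [zero_add, show forcedCount x0 x 0 = 0 by simp [forcedCount], Nat.Ico_zero_eq_range]
    at h
  have h2 : ∑ k ∈ Finset.range (forcedCount x0 x t / d * d),
      (inner ℝ (x0 (Fin.ofNat d k) : E d) v : ℝ) ^ 2 ≤ ∑ k ∈ Finset.range (forcedCount x0 x t),
      (inner ℝ (x0 (Fin.ofNat d k) : E d) v : ℝ) ^ 2 :=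
    Finset.sum_le_sum_of_subset_of_nonneg (Finset.range_mono (Nat.div_mul_le_self _ _))
      fun _ _ _ => sq_nonneg _
  rw [sum_cycles (fun i => (inner ℝ (x0 i : E d) v : ℝ) ^ 2)] at h2
  have h3 := mul_le_mul_of_nonneg_left (lambdaMin_x0_mul_le (x0 := x0) v)
    (Nat.cast_nonneg (α := ℝ) (forcedCount x0 x t / d))
  have h4 : ∑ j ∈ Finset.Icc 1 0, (inner ℝ (x j : E d) v : ℝ) ^ 2 = 0 := by simp
  linarith

/-- At a forced time the completed cycles alone contribute less than `cX0 x0 * √t` to `λ_min(A_t)`,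
which bounds their number by `√t / √d`. The incomplete cycle costs `d` and the new exploration costs
`1`; at unforced times the count does not move. -/
lemma forcedCount_le (h0 : 0 < lambdaMin (∑ i, outer (x0 i : E d)))
    (hx : ∀ t, Forced x0 x t → x (t + 1) = x0 (rrIndex x0 x t)) (t : ℕ) :
    (forcedCount x0 x t : ℝ) ≤ √d * √t + d + 1 := by
  have hd : 0 < √(d : ℝ) := Real.sqrt_pos.2 (by exact_mod_cast Nat.pos_of_neZero d)
  induction t with
  | zero => simp [forcedCount]; positivity
  | succ t ih =>
    have hmono : √(t : ℝ) ≤ √((t + 1 : ℕ) : ℝ) := Real.sqrt_le_sqrt (by simp)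
    have hmul := mul_le_mul_of_nonneg_left hmono hd.le
    by_cases h : Forced x0 x t
    · rw [forcedCount_succ_of_forced h]
      have h1 := (mul_le_lambdaMin_design hx t).trans_lt h
      rw [← cX0_mul_sqrt] at h1
      have h2 : ((forcedCount x0 x t / d : ℕ) : ℝ) * √d < √t := by
        have := cX0_pos h0
        nlinarith
      have h3 : (forcedCount x0 x t : ℝ) ≤ ((forcedCount x0 x t / d : ℕ) : ℝ) * d + d := by
        have := (Nat.lt_div_mul_add (a := forcedCount x0 x t) (Nat.pos_of_neZero d)).le
        exact_mod_cast this
      have h4 : ((forcedCount x0 x t / d : ℕ) : ℝ) * d ≤ √d * √t := by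
        have h5 : √(d : ℝ) * √d = d := Real.mul_self_sqrt (Nat.cast_nonneg d)
        calc ((forcedCount x0 x t / d : ℕ) : ℝ) * d
            = √d * (((forcedCount x0 x t / d : ℕ) : ℝ) * √d) := by rw [← h5]; ring_nf; simp
          _ ≤ √d * √t := by gcongr
      push_cast at *
      linarith
    · rw [forcedCount_succ_of_not_forced h]
      linarith

/-- Among the times `t, …, t + d - 1`, either one is unforced, and then the bound holds there and
persists, or all are forced and a full cycle raises `λ_min` by `cX0 x0 * √d`. In the second case the
claim at `t - d` suffices, because `√t ≤ √(t - d) + √d`. -/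
lemma cX0_mul_sqrt_le_lambdaMin (h0 : 0 < lambdaMin (∑ i, outer (x0 i : E d)))
    (hx : ∀ t, Forced x0 x t → x (t + 1) = x0 (rrIndex x0 x t)) (t : ℕ) :
    cX0 x0 * √t ≤ lambdaMin (design x (t + d)) := by
  have hc := cX0_pos h0
  induction t using Nat.strong_induction_on with
  | _ t ih =>
    by_cases h : ∃ s, t ≤ s ∧ s < t + d ∧ ¬ Forced x0 x s
    · obtain ⟨s, h1, h2, h3⟩ := h
      calc cX0 x0 * √t ≤ cX0 x0 * √s := by gcongr
        _ ≤ lambdaMin (design x s) := not_lt.1 h3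
        _ ≤ _ := lambdaMin_design_mono h2.le
    · push Not at h
      have hcount : ∀ n ≤ d, forcedCount x0 x (t + n) = forcedCount x0 x t + n := by
        intro n hn
        induction n with
        | zero => rfl
        | succ n ihn =>
          rw [← add_assoc, forcedCount_succ_of_forced (h _ (by omega) (by omega)),
            ihn (by omega), add_assoc]
      have hstep : lambdaMin (design x t) + lambdaMin (∑ i, outer (x0 i : E d))
          ≤ lambdaMin (design x (t + d)) := by
        refine le_lambdaMin_design x _ fun v => ?_
        have h := sum_forced_le hx (fun a => (inner ℝ (a : E d) v : ℝ) ^ 2)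
          (fun a => sq_nonneg _) t d
        rw [hcount d le_rfl, Finset.sum_Ico_eq_sum_range, Nat.add_sub_cancel_left,
          sum_cycle (fun i => (inner ℝ (x0 i : E d) v : ℝ) ^ 2)] at h
        linarith [lambdaMin_design_mul_le x t v, lambdaMin_x0_mul_le (x0 := x0) v]
      rcases lt_or_ge t d with htd | htd
      -- There is no earlier window to induct on here, but the single full cycle is already enough
      -- since `√t ≤ √d`.
      · have h1 : 0 ≤ lambdaMin (design x t) :=
          le_lambdaMin_design x t fun v => by
            rw [zero_mul]; exact Finset.sum_nonneg fun _ _ => sq_nonneg _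
        have h2 : cX0 x0 * √t ≤ cX0 x0 * √d := by gcongr
        rw [cX0_mul_sqrt] at h2
        linarith
      · obtain ⟨t', rfl⟩ := Nat.exists_eq_add_of_le' htd
        have h1 := ih t' (by have := Nat.pos_of_neZero d; omega)
        have h2 : √((t' + d : ℕ) : ℝ) ≤ √t' + √d := by
          push_cast
          refine Real.sqrt_le_iff.2 ⟨by positivity, ?_⟩
          have e1 := Real.sq_sqrt (Nat.cast_nonneg (α := ℝ) t')
          have e2 := Real.sq_sqrt (Nat.cast_nonneg (α := ℝ) d)
          have : 0 ≤ √(t' : ℝ) * √(d : ℝ) := by positivity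
          nlinarith
        have h3 := mul_le_mul_of_nonneg_left h2 hc.le
        rw [mul_add, cX0_mul_sqrt] at h3
        linarith

lemma half_cX0_mul_sqrt_le_lambdaMin (h0 : 0 < lambdaMin (∑ i, outer (x0 i : E d)))
    (hx : ∀ t, Forced x0 x t → x (t + 1) = x0 (rrIndex x0 x t)) {t : ℕ} (ht : 2 * d ≤ t) :
    cX0 x0 / 2 * √t ≤ lambdaMin (design x t) := by
  have hc := cX0_pos h0
  have h := cX0_mul_sqrt_le_lambdaMin h0 hx (t - d)
  rw [Nat.sub_add_cancel (by omega)] at h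
  refine le_trans ?_ h
  have : √(t : ℝ) / 2 ≤ √((t - d : ℕ) : ℝ) := by
    refine Real.le_sqrt_of_sq_le ?_
    rw [div_pow, Real.sq_sqrt (Nat.cast_nonneg _), Nat.cast_sub (by omega)]
    have : (2 * d : ℝ) ≤ t := by exact_mod_cast ht
    linarith [Nat.cast_nonneg (α := ℝ) d]
  nlinarith

end Growth

/-! ### Tracking -/

lemma cumWeight_nonneg {d : ℕ} {𝒳 : Finset (E d)} {w : ℕ → 𝒳 → ℝ}
    (hw : ∀ t, 1 ≤ t → w t ∈ stdSimplex ℝ 𝒳) (t : ℕ) (a : 𝒳) : 0 ≤ cumWeight w t a :=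
  Finset.sum_nonneg fun s hs => (hw s (Finset.mem_Icc.1 hs).1).1 a

lemma sum_cumWeight {d : ℕ} {𝒳 : Finset (E d)} {w : ℕ → 𝒳 → ℝ}
    (hw : ∀ t, 1 ≤ t → w t ∈ stdSimplex ℝ 𝒳) (t : ℕ) : ∑ a, cumWeight w t a = t := by
  unfold cumWeight
  rw [Finset.sum_comm, Finset.sum_congr rfl (g := fun _ => (1 : ℝ))
    (fun s hs => (hw s (Finset.mem_Icc.1 hs).1).2)]
  simp

lemma cumWeight_succ {d : ℕ} {𝒳 : Finset (E d)} (w : ℕ → 𝒳 → ℝ) (t : ℕ) (a : 𝒳) :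
    cumWeight w (t + 1) a = cumWeight w t a + w (t + 1) a :=
  Finset.sum_Icc_succ_top (by omega) _

section Tracking

variable {d : ℕ} {𝒳 : Finset (E d)} {x0 : Fin d → 𝒳} {x : ℕ → 𝒳} {w : ℕ → 𝒳 → ℝ}
  (hw : ∀ t, 1 ≤ t → w t ∈ stdSimplex ℝ 𝒳)
  (htr : ∀ t, 1 ≤ t → ¬ Forced x0 x t →
    0 < cumWeight w t (x (t + 1)) ∧
    ∀ a : 𝒳, 0 < cumWeight w t a →
      (pulls x t (x (t + 1)) : ℝ) - cumWeight w t (x (t + 1)) ≤ (pulls x t a : ℝ) - cumWeight w t a)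

include hw htr

/-- Pulls and cumulated weights have the same total `t`, so the smallest excess cannot be positive;
arms without weight have nonnegative excess and do not spoil the comparison. -/
lemma pulls_le_cumWeight_of_not_forced {t : ℕ} (ht : 1 ≤ t) (h : ¬ Forced x0 x t) :
    (pulls x t (x (t + 1)) : ℝ) ≤ cumWeight w t (x (t + 1)) := by
  obtain ⟨h1, h2⟩ := htr t ht h
  by_contra! hlt
  have : ∑ a, cumWeight w t a < ∑ a, (pulls x t a : ℝ) := by
    refine Finset.sum_lt_sum (fun a _ => ?_) ⟨x (t + 1), Finset.mem_univ _, hlt⟩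
    rcases (cumWeight_nonneg hw t a).eq_or_lt with h0 | h0
    · rw [← h0]; exact Nat.cast_nonneg _
    · linarith [h2 a h0]
  rw [sum_cumWeight hw, sum_pulls] at this
  exact lt_irrefl _ this

/-- A tracking pull goes only to an arm without excess, so it creates at most `1`; any further
excess comes from forced rounds. The same `1` covers the arbitrary first arm. -/
lemma pulls_le_cumWeight_add {t : ℕ} (ht : 1 ≤ t) (a : 𝒳) :
    (pulls x t a : ℝ) ≤ cumWeight w t a + 1 + forcedCount x0 x t := by
  classical
  induction t, ht using Nat.le_induction with
  | base =>
    have h1 : (pulls x 1 a : ℝ) ≤ ∑ b, (pulls x 1 b : ℝ) :=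
      Finset.single_le_sum (f := fun b => (pulls x 1 b : ℝ)) (fun _ _ => Nat.cast_nonneg _)
        (Finset.mem_univ a)
    rw [sum_pulls] at h1
    have := cumWeight_nonneg hw 1 a
    push_cast at h1
    linarith [Nat.cast_nonneg (α := ℝ) (forcedCount x0 x 1)]
  | succ t ht ih =>
    have hwn : 0 ≤ w (t + 1) a := (hw (t + 1) (by omega)).1 a
    rw [pulls_succ, cumWeight_succ]
    by_cases h : Forced x0 x t
    · rw [forcedCount_succ_of_forced h]
      split_ifs <;> push_cast <;> linarith
    · rw [forcedCount_succ_of_not_forced h]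
      split_ifs with hxa
      · have := pulls_le_cumWeight_of_not_forced hw htr ht h
        rw [hxa] at this
        push_cast
        linarith [Nat.cast_nonneg (α := ℝ) (forcedCount x0 x t)]
      · push_cast
        linarith

/-- The totals agree, so the deficit of one arm is the combined excess of the others. -/
lemma cumWeight_le_pulls_add {t : ℕ} (ht : 1 ≤ t) (a : 𝒳) :
    cumWeight w t a ≤ pulls x t a + Fintype.card 𝒳 * (1 + forcedCount x0 x t) := by
  classical
  have h1 := sum_pulls x t
  have h2 := sum_cumWeight hw t
  rw [← Finset.add_sum_erase _ _ (Finset.mem_univ a)] at h1 h2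
  have h3 : ∑ b ∈ Finset.univ.erase a, (pulls x t b : ℝ)
      ≤ ∑ b ∈ Finset.univ.erase a, (cumWeight w t b + (1 + forcedCount x0 x t)) :=
    Finset.sum_le_sum fun b _ => by linarith [pulls_le_cumWeight_add hw htr ht b]
  have h4 : ∑ _b ∈ (Finset.univ : Finset 𝒳).erase a, (1 + forcedCount x0 x t : ℝ)
      ≤ ∑ _b : 𝒳, (1 + forcedCount x0 x t : ℝ) :=
    Finset.sum_le_sum_of_subset_of_nonneg (Finset.erase_subset _ _) fun _ _ _ => by positivity
  rw [Finset.sum_add_distrib] at h3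
  rw [Finset.sum_const (s := (Finset.univ : Finset 𝒳)), Finset.card_univ, nsmul_eq_mul] at h4
  linarith

end Tracking

/-! ### The logistic function -/

lemma dmu_eq (z : ℝ) : dmu z = Real.sigmoid z * (1 - Real.sigmoid z) := by
  rw [dmu, Real.deriv_sigmoid]

lemma dmu_pos (z : ℝ) : 0 < dmu z := by
  rw [dmu_eq]
  exact mul_pos (Real.sigmoid_pos z) (sub_pos.2 (Real.sigmoid_lt_one z))

lemma dmu_le_one (z : ℝ) : dmu z ≤ 1 := by
  rw [dmu_eq]
  nlinarith [Real.sigmoid_pos z, Real.sigmoid_lt_one z]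

lemma continuous_dmu : Continuous dmu := by
  have : dmu = fun z => Real.sigmoid z * (1 - Real.sigmoid z) := funext dmu_eq
  rw [this]
  have := continuous_sigmoid
  fun_prop

lemma exists_le_dmu {R : ℝ} (hR : 0 ≤ R) :
    ∃ m : ℝ, 0 < m ∧ m ≤ 1 ∧ ∀ z, |z| ≤ R → m ≤ dmu z := by
  obtain ⟨z0, -, hz0⟩ := (isCompact_Icc (a := -R) (b := R)).exists_isMinOn
    ⟨0, by simp [hR]⟩ continuous_dmu.continuousOn
  exact ⟨dmu z0, dmu_pos z0, dmu_le_one z0, fun z hz => hz0 (abs_le.1 hz)⟩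

lemma mul_sq_le_sigmoid_sub_mul {R m : ℝ} (hm : ∀ z, |z| ≤ R → m ≤ dmu z) {y z : ℝ}
    (hy : |y| ≤ R) (hz : |z| ≤ R) :
    m * (y - z) ^ 2 ≤ (Real.sigmoid y - Real.sigmoid z) * (y - z) := by
  have key : ∀ y z : ℝ, |y| ≤ R → |z| ≤ R → z ≤ y →
      m * (y - z) ≤ Real.sigmoid y - Real.sigmoid z := by
    intro y z hy hz hzy
    refine (convex_Icc (-R) R).mul_sub_le_image_sub_of_le_deriv continuous_sigmoid.continuousOn
      (differentiable_sigmoid.differentiableOn) (fun w hw => ?_) z (abs_le.1 hz) y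
      (abs_le.1 hy) hzy
    have hw' := interior_subset hw
    exact hm w (abs_le.2 hw')
  rcases le_total z y with h | h
  · nlinarith [key y z hy hz h]
  · nlinarith [key z y hz hy h]

lemma hasDerivAt_logistic_loss (ρ z : ℝ) :
    HasDerivAt (fun z => ρ * Real.log (Real.sigmoid z) + (1 - ρ) * Real.log (1 - Real.sigmoid z))
      (ρ - Real.sigmoid z) z := by
  have h0 := (Real.sigmoid_pos z).ne'
  have h1 := (sub_pos.2 (Real.sigmoid_lt_one z)).ne'
  have h := (((Real.hasDerivAt_sigmoid z).log h0).const_mul ρ).add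
    ((((Real.hasDerivAt_sigmoid z).const_sub 1).log h1).const_mul (1 - ρ))
  refine h.congr_deriv ?_
  field_simp
  ring

/-- Concavity: the derivative `ρ - μ` is decreasing, whatever the real number `ρ`. -/
lemma logistic_loss_le_tangent (ρ y z : ℝ) :
    ρ * Real.log (Real.sigmoid y) + (1 - ρ) * Real.log (1 - Real.sigmoid y)
      ≤ ρ * Real.log (Real.sigmoid z) + (1 - ρ) * Real.log (1 - Real.sigmoid z)
        + (ρ - Real.sigmoid z) * (y - z) := by
  set f := fun z => ρ * Real.log (Real.sigmoid z) + (1 - ρ) * Real.log (1 - Real.sigmoid z) with hf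
  have hd : ∀ z, HasDerivAt f (ρ - Real.sigmoid z) z := hasDerivAt_logistic_loss ρ
  have hc : Continuous f := continuous_iff_continuousAt.2 fun z => (hd z).continuousAt
  change f y ≤ f z + _
  rcases lt_trichotomy y z with h | h | h
  · obtain ⟨ξ, hξ, he⟩ := exists_hasDerivAt_eq_slope f _ h hc.continuousOn fun w _ => hd w
    rw [eq_div_iff (by linarith)] at he
    nlinarith [Real.sigmoid_le hξ.2.le]
  · simp [h]
  · obtain ⟨ξ, hξ, he⟩ := exists_hasDerivAt_eq_slope f _ h hc.continuousOn fun w _ => hd w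
    rw [eq_div_iff (by linarith)] at he
    nlinarith [Real.sigmoid_le hξ.1.le]

/-! ### Maximum likelihood -/

section MLE

variable {d : ℕ} {𝒳 : Finset (E d)} (x : ℕ → 𝒳) (r : ℕ → ℝ) (t : ℕ)

/-- The gradient at `θ` of the log-likelihood. -/
noncomputable def score {d : ℕ} {𝒳 : Finset (E d)} (x : ℕ → 𝒳) (r : ℕ → ℝ) (t : ℕ) (θ : E d) :
    E d :=
  ∑ s ∈ Finset.Icc 1 t, (r s - Real.sigmoid (inner ℝ (x s : E d) θ)) • (x s : E d)

lemma inner_score (θ v : E d) :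
    (inner ℝ v (score x r t θ) : ℝ) = ∑ s ∈ Finset.Icc 1 t,
      (r s - Real.sigmoid (inner ℝ (x s : E d) θ)) * inner ℝ (x s : E d) v := by
  rw [score, inner_sum]
  exact Finset.sum_congr rfl fun s _ => by rw [real_inner_smul_right, real_inner_comm v]

lemma score_sub_score (θ θ' : E d) :
    score x r t θ - score x r t θ' = gvec x t θ' - gvec x t θ := by
  simp only [score, gvec, ← Finset.sum_sub_distrib, ← sub_smul]
  exact Finset.sum_congr rfl fun s _ => by congr 1; ring

lemma logLik_le_tangent (θ θ' : E d) :
    logLik x r t θ' ≤ logLik x r t θ + inner ℝ (θ' - θ) (score x r t θ) := by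
  rw [inner_score, logLik, logLik, ← Finset.sum_add_distrib]
  refine Finset.sum_le_sum fun s _ => ?_
  rw [inner_sub_right]
  exact logistic_loss_le_tangent _ _ _

lemma continuous_logLik : Continuous (logLik x r t) := by
  unfold logLik
  refine continuous_finsetSum _ fun s _ => ?_
  have h : Continuous fun z => r s * Real.log (Real.sigmoid z)
      + (1 - r s) * Real.log (1 - Real.sigmoid z) :=
    continuous_iff_continuousAt.2 fun z => (hasDerivAt_logistic_loss (r s) z).continuousAt
  exact h.comp (by fun_prop : Continuous fun θ : E d => (inner ℝ (x s : E d) θ : ℝ))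

variable {x r t}

lemma IsMLE.score_eq_zero {θ : E d} (h : IsMLE x r t θ) : score x r t θ = 0 := by
  have hd : ∀ v : E d, HasDerivAt (fun ε : ℝ => logLik x r t (θ + ε • v))
      (inner ℝ v (score x r t θ)) 0 := by
    intro v
    rw [inner_score]
    unfold logLik
    refine HasDerivAt.fun_sum fun s _ => ?_
    have h1 : HasDerivAt (fun ε : ℝ => (inner ℝ (x s : E d) (θ + ε • v) : ℝ))
        (inner ℝ (x s : E d) v) 0 := by
      simp only [inner_add_right, real_inner_smul_right]
      simpa using ((hasDerivAt_id (0 : ℝ)).mul_const (inner ℝ (x s : E d) v : ℝ)).const_add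
        (inner ℝ (x s : E d) θ : ℝ)
    have h2 := hasDerivAt_logistic_loss (r s) (inner ℝ (x s : E d) (θ + (0 : ℝ) • v))
    have h3 := HasDerivAt.comp (0 : ℝ) h2 h1
    refine (HasDerivAt.congr_deriv h3 ?_ :)
    rw [zero_smul, add_zero]
  have hz : ∀ v : E d, (inner ℝ v (score x r t θ) : ℝ) = 0 := fun v =>
    IsLocalMax.hasDerivAt_eq_zero (Filter.Eventually.of_forall fun ε => by simpa using h _) (hd v)
  exact inner_self_eq_zero.1 (hz (score x r t θ))

lemma abs_inner_arm_le (hball : ∀ a ∈ 𝒳, ‖a‖ ≤ 1) (a : 𝒳) (v : E d) :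
    |(inner ℝ (a : E d) v : ℝ)| ≤ ‖v‖ :=
  (abs_real_inner_le_norm _ _).trans
    (mul_le_of_le_one_left (norm_nonneg v) (hball a a.2))

/-- Strong monotonicity of `g_t` on a ball. -/
lemma mul_sum_sq_le_inner_gvec_sub (hball : ∀ a ∈ 𝒳, ‖a‖ ≤ 1) {R m : ℝ}
    (hm : ∀ z, |z| ≤ R → m ≤ dmu z) {θ θ' : E d} (hθ : ‖θ‖ ≤ R) (hθ' : ‖θ'‖ ≤ R) :
    m * ∑ s ∈ Finset.Icc 1 t, (inner ℝ (x s : E d) (θ - θ') : ℝ) ^ 2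
      ≤ inner ℝ (θ - θ') (gvec x t θ - gvec x t θ') := by
  rw [gvec, gvec, ← Finset.sum_sub_distrib, inner_sum, Finset.mul_sum]
  refine Finset.sum_le_sum fun s _ => ?_
  rw [← sub_smul, real_inner_smul_right, real_inner_comm (x s : E d), inner_sub_right]
  exact mul_sq_le_sigmoid_sub_mul hm ((abs_inner_arm_le hball _ _).trans hθ)
    ((abs_inner_arm_le hball _ _).trans hθ')

/-- On the unit sphere around `θ`, strong monotonicity of `g_t` outweighs the score at `θ`, so the
outward derivative of the log-likelihood is nonpositive. By concavity no point outside the ball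
beats the sphere, and a maximizer over the compact ball is global. -/
lemma exists_isMLE (hball : ∀ a ∈ 𝒳, ‖a‖ ≤ 1) {R m : ℝ} (hm : ∀ z, |z| ≤ R → m ≤ dmu z)
    {θ : E d} (hθ : ‖θ‖ + 1 ≤ R)
    (hs : ∀ u : E d, ‖u‖ = 1 → (inner ℝ u (score x r t θ) : ℝ)
      ≤ m * ∑ s ∈ Finset.Icc 1 t, (inner ℝ (x s : E d) u : ℝ) ^ 2) :
    ∃ θ', IsMLE x r t θ' := by
  obtain ⟨θ', -, hθ'⟩ := (isCompact_closedBall θ 1).exists_isMaxOn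
    ⟨θ, Metric.mem_closedBall_self zero_le_one⟩ (continuous_logLik x r t).continuousOn
  refine ⟨θ', fun ϑ => ?_⟩
  by_cases hϑ : ϑ ∈ Metric.closedBall θ 1
  · exact hθ' hϑ
  rw [mem_closedBall_iff_norm, not_le] at hϑ
  set ρ := ‖ϑ - θ‖ with hρ
  set u : E d := ρ⁻¹ • (ϑ - θ) with hu
  have hρ0 : 0 < ρ := by linarith
  have hu1 : ‖u‖ = 1 := by
    rw [hu, norm_smul, norm_inv, Real.norm_of_nonneg hρ0.le, ← hρ, inv_mul_cancel₀ hρ0.ne']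
  have hmem : θ + u ∈ Metric.closedBall θ 1 := by
    simp [hu1]
  refine le_trans ?_ (hθ' hmem)
  refine (logLik_le_tangent x r t (θ + u) ϑ).trans ?_
  have h1 : ϑ - (θ + u) = (ρ - 1) • u := by
    have : ρ • u = ϑ - θ := by rw [hu, smul_smul, mul_inv_cancel₀ hρ0.ne', one_smul]
    rw [sub_smul, this, one_smul]
    abel
  have h2 := mul_sum_sq_le_inner_gvec_sub (x := x) (t := t) hball hm (θ := θ + u) (θ' := θ)
    ((norm_add_le _ _).trans (by rw [hu1]; exact hθ)) (by linarith)
  rw [add_sub_cancel_left, ← score_sub_score x r, inner_sub_right] at h2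
  rw [h1, real_inner_smul_left]
  nlinarith [hs u hu1]

end MLE

/-! ### The projected estimate -/

lemma isHermitian_fisher {d : ℕ} {𝒳 : Finset (E d)} (x : ℕ → 𝒳) (t : ℕ) (θ : E d) :
    (fisher x t θ).IsHermitian :=
  isHermitian_weighted _ (fun s => dmu (inner ℝ (x s : E d) θ)) _

lemma mul_sum_sq_le_fisher {d : ℕ} {𝒳 : Finset (E d)} (hball : ∀ a ∈ 𝒳, ‖a‖ ≤ 1) (x : ℕ → 𝒳)
    (t : ℕ) {R m : ℝ} (hm : ∀ z, |z| ≤ R → m ≤ dmu z) {θ : E d} (hθ : ‖θ‖ ≤ R) (v : E d) :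
    m * ∑ s ∈ Finset.Icc 1 t, (inner ℝ (x s : E d) v : ℝ) ^ 2
      ≤ ∑ s ∈ Finset.Icc 1 t, dmu (inner ℝ (x s : E d) θ) * (inner ℝ (x s : E d) v : ℝ) ^ 2 := by
  rw [Finset.mul_sum]
  exact Finset.sum_le_sum fun s _ => mul_le_mul_of_nonneg_right
    (hm _ ((abs_inner_arm_le hball _ _).trans hθ)) (sq_nonneg _)

lemma fisher_sum_le {d : ℕ} {𝒳 : Finset (E d)} (x : ℕ → 𝒳) (t : ℕ) (θ v : E d) :
    ∑ s ∈ Finset.Icc 1 t, dmu (inner ℝ (x s : E d) θ) * (inner ℝ (x s : E d) v : ℝ) ^ 2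
      ≤ ∑ s ∈ Finset.Icc 1 t, (inner ℝ (x s : E d) v : ℝ) ^ 2 :=
  Finset.sum_le_sum fun _ _ => mul_le_of_le_one_left (sq_nonneg _) (dmu_le_one _)

lemma posDef_fisher {d : ℕ} {𝒳 : Finset (E d)} (hball : ∀ a ∈ 𝒳, ‖a‖ ≤ 1) {x : ℕ → 𝒳}
    {t : ℕ} (hl : 0 < lambdaMin (design x t)) (θ : E d) : (fisher x t θ).PosDef := by
  obtain ⟨m, hm0, -, hm⟩ := exists_le_dmu (norm_nonneg θ)
  refine posDef_of_le_sqNorm (isHermitian_fisher x t θ) (mul_pos hm0 hl) fun v => ?_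
  rw [sqNorm_fisher]
  refine le_trans ?_ (mul_sum_sq_le_fisher hball x t hm le_rfl v)
  rw [mul_assoc]
  exact mul_le_mul_of_nonneg_left (lambdaMin_design_mul_le x t v) hm0.le

lemma posDef_design {d : ℕ} {𝒳 : Finset (E d)} {x : ℕ → 𝒳}
    {t : ℕ} (hl : 0 < lambdaMin (design x t)) : (design x t).PosDef :=
  posDef_of_le_sqNorm (isHermitian_sum_outer _ _) hl
    (lambdaMin_mul_le (isHermitian_sum_outer _ _))

/-- If the score at the true parameter is at most `D` in the dual norm of `A_t`, with `D` small
compared to `√λ_min(A_t)`, then the projected estimate is close to the true parameter. -/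
lemma IsRun.norm_proj_sub_le {d : ℕ} [NeZero d] {I : Type*} {𝒳 : Finset (E d)} {S : ℝ}
    {istar : E d → I} {x0 : Fin d → 𝒳} {x : ℕ → 𝒳} {r : ℕ → ℝ} {θhat θproj : ℕ → E d}
    {w : ℕ → 𝒳 → ℝ} (hrun : IsRun 𝒳 S istar x0 x r θhat θproj w)
    (hball : ∀ a ∈ 𝒳, ‖a‖ ≤ 1) {θstar : E d} (hθ : θstar ∈ Theta d S) {m : ℝ} (hm0 : 0 < m)
    (hm1 : m ≤ 1) (hm : ∀ z, |z| ≤ S + 1 → m ≤ dmu z) {t : ℕ} (ht : 1 ≤ t) {D : ℝ} (hD : 0 ≤ D)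
    (hscore : ∀ u : E d, |(inner ℝ u (score x r t θstar) : ℝ)|
      ≤ D * √(∑ s ∈ Finset.Icc 1 t, (inner ℝ (x s : E d) u : ℝ) ^ 2))
    (hl : 0 < lambdaMin (design x t)) (hDl : D ≤ m * √(lambdaMin (design x t))) :
    m ^ 2 * (√(lambdaMin (design x t)) * ‖θproj t - θstar‖) ≤ 2 * D := by
  have hθS : ‖θstar‖ ≤ S := hθ
  have hroot : ∀ u : E d, √(lambdaMin (design x t)) * ‖u‖
      ≤ √(∑ s ∈ Finset.Icc 1 t, (inner ℝ (x s : E d) u : ℝ) ^ 2) := fun u => by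
    refine Real.le_sqrt_of_sq_le ?_
    rw [mul_pow, Real.sq_sqrt hl.le]
    exact lambdaMin_design_mul_le x t u
  have hex : ∃ θ', IsMLE x r t θ' := by
    refine exists_isMLE hball hm (by linarith) fun u hu => ?_
    have h1 := hroot u
    rw [hu, mul_one] at h1
    set Q := ∑ s ∈ Finset.Icc 1 t, (inner ℝ (x s : E d) u : ℝ) ^ 2
    have hQ : √Q * √Q = Q := Real.mul_self_sqrt (Finset.sum_nonneg fun _ _ => sq_nonneg _)
    calc (inner ℝ u (score x r t θstar) : ℝ) ≤ D * √Q := (le_abs_self _).trans (hscore u)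
      _ ≤ m * √Q * √Q := by gcongr; exact hDl.trans (by gcongr)
      _ = m * Q := by rw [mul_assoc, hQ]
  have hhat := (hrun.mle t ht hex).score_eq_zero
  have hmin := hrun.proj_min t ht hex (posDef_design hl) θstar hθ
  have hpS : ‖θproj t‖ ≤ S := hrun.proj_mem t ht
  have hgs : gvec x t θstar - gvec x t (θhat t) = - score x r t θstar := by
    rw [← score_sub_score x r, hhat, zero_sub]
  have hdual : ∀ θ y : E d, ∃ u : E d, wNorm (fisher x t θ)⁻¹ y ^ 2 = inner ℝ u y ∧
      wNorm (fisher x t θ)⁻¹ y ^ 2 = ∑ s ∈ Finset.Icc 1 t, dmu (inner ℝ (x s : E d) θ)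
        * (inner ℝ (x s : E d) u : ℝ) ^ 2 ∧
      ∀ v : E d, (inner ℝ v y : ℝ) ≤ √(∑ s ∈ Finset.Icc 1 t, dmu (inner ℝ (x s : E d) θ)
        * (inner ℝ (x s : E d) v : ℝ) ^ 2) * wNorm (fisher x t θ)⁻¹ y := fun θ y =>
    exists_dual_weighted (Finset.Icc 1 t) (fun s => dmu (inner ℝ (x s : E d) θ))
      (fun s => (x s : E d)) (fun s _ => (dmu_pos _).le) (posDef_fisher hball hl θ) y
  have hnn : ∀ θ y : E d, 0 ≤ wNorm (fisher x t θ)⁻¹ y := fun θ y => Real.sqrt_nonneg _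
  -- the dual norm of the score at the true parameter
  set n := wNorm (fisher x t θstar)⁻¹ (gvec x t θstar - gvec x t (θhat t)) with hn
  have hn0 : 0 ≤ n := hnn _ _
  -- Testing the score bound on the dual vector `u` gives `n² ≤ D √Q`, while `m √Q ≤ n` because `m²
  -- ≤ m`.
  have hnD : m * n ≤ D := by
    obtain ⟨u, hu1, hu2, -⟩ := hdual θstar (gvec x t θstar - gvec x t (θhat t))
    rw [← hn] at hu1 hu2
    have h1 := mul_sum_sq_le_fisher hball x t hm (θ := θstar) (by linarith) u
    rw [← hu2] at h1
    set Q := ∑ s ∈ Finset.Icc 1 t, (inner ℝ (x s : E d) u : ℝ) ^ 2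
    have hQ0 : 0 ≤ Q := Finset.sum_nonneg fun _ _ => sq_nonneg _
    have h2 : m * √Q ≤ n := by
      refine abs_le_of_sq_le_sq' ?_ hn0 |>.2
      rw [mul_pow, Real.sq_sqrt hQ0]
      nlinarith [mul_nonneg hm0.le hQ0]
    have h3 : n ^ 2 ≤ D * √Q := by
      rw [hu1, hgs, inner_neg_right]
      exact (neg_le_abs _).trans (hscore u)
    rcases hn0.eq_or_lt with h | h
    · rw [← h, mul_zero]; exact hD
    · have : m * n * n ≤ D * n := by nlinarith
      exact le_of_mul_le_mul_right this h
  set v := θproj t - θstar with hv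
  have hmono := mul_sum_sq_le_inner_gvec_sub (x := x) (t := t) hball hm (θ := θproj t)
    (θ' := θstar) (by linarith) (by linarith)
  rw [← hv] at hmono
  set Q := ∑ s ∈ Finset.Icc 1 t, (inner ℝ (x s : E d) v : ℝ) ^ 2
  have hQ0 : 0 ≤ Q := Finset.sum_nonneg fun _ _ => sq_nonneg _
  -- The difference `g_t(θproj) - g_t(θ*)` is split at `θhat`: minimality of the projection bounds
  -- the first part by `n`, and the second is the score at `θ*`. No bound on the norm of `θhat` is
  -- needed.
  obtain ⟨-, -, -, hcs1⟩ := hdual (θproj t) (gvec x t (θproj t) - gvec x t (θhat t))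
  have h1 := hcs1 v
  have h2 : (inner ℝ v (gvec x t (θproj t) - gvec x t (θhat t)) : ℝ) ≤ √Q * n :=
    h1.trans (mul_le_mul (Real.sqrt_le_sqrt (fisher_sum_le x t _ v)) hmin (hnn _ _)
      (Real.sqrt_nonneg _))
  have h3 : (inner ℝ v (gvec x t (θhat t) - gvec x t θstar) : ℝ) ≤ D * √Q := by
    have : gvec x t (θhat t) - gvec x t θstar = score x r t θstar := by
      rw [← neg_sub, hgs, neg_neg]
    rw [this]
    exact (le_abs_self _).trans (hscore v)
  have h4 : (inner ℝ v (gvec x t (θproj t) - gvec x t θstar) : ℝ)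
      = inner ℝ v (gvec x t (θproj t) - gvec x t (θhat t))
        + inner ℝ v (gvec x t (θhat t) - gvec x t θstar) := by
    rw [← inner_add_right, sub_add_sub_cancel]
  have hQ : √Q * √Q = Q := Real.mul_self_sqrt hQ0
  have h5 : m ^ 2 * Q ≤ 2 * D * √Q := by
    have h6 : m * Q ≤ √Q * n + D * √Q := by linarith
    have h7 : m * (m * Q) ≤ m * (√Q * n + D * √Q) := mul_le_mul_of_nonneg_left h6 hm0.le
    have h8 : √Q * (m * n) ≤ √Q * D := by gcongr
    have h9 : m * (D * √Q) ≤ 1 * (D * √Q) := by gcongr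
    nlinarith
  have h6 : m ^ 2 * √Q ≤ 2 * D := by
    rcases (Real.sqrt_nonneg Q).eq_or_lt with h | h
    · rw [← h, mul_zero]; positivity
    · refine le_of_mul_le_mul_right ?_ h
      rw [mul_assoc, hQ]
      exact h5
  exact (mul_le_mul_of_nonneg_left (hroot v) (by positivity)).trans h6

/-- The sum of the noise over the rounds in which arm `a` was selected. -/
noncomputable def noise {d : ℕ} {𝒳 : Finset (E d)} (x : ℕ → 𝒳) (r : ℕ → ℝ) (θ : E d) (t : ℕ)
    (a : 𝒳) : ℝ :=
  open Classical in
  ∑ s ∈ Finset.Icc 1 t, if x s = a then r s - Real.sigmoid (inner ℝ (a : E d) θ) else 0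

/-- Grouping by arm reduces a vector-valued concentration problem to finitely many scalar ones. -/
lemma inner_score_eq_sum_noise {d : ℕ} {𝒳 : Finset (E d)} (x : ℕ → 𝒳) (r : ℕ → ℝ) (θ : E d)
    (t : ℕ) (u : E d) :
    (inner ℝ u (score x r t θ) : ℝ) = ∑ a : 𝒳, inner ℝ (a : E d) u * noise x r θ t a := by
  classical
  simp only [inner_score, noise, Finset.mul_sum]
  rw [Finset.sum_comm]
  refine Finset.sum_congr rfl fun s _ => ?_
  simp [mul_comm]

/-- The part proportional to the pulls is a sum over rounds, handled by Cauchy-Schwarz at the price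
`√t`. The constant part uses `‖u‖ ≤ √Q / √λ_min(A_t)`. -/
lemma abs_inner_score_le {d : ℕ} {𝒳 : Finset (E d)} (hball : ∀ a ∈ 𝒳, ‖a‖ ≤ 1) {x : ℕ → 𝒳}
    {r : ℕ → ℝ} {θ : E d} {t : ℕ} {α β : ℝ} (hα : 0 ≤ α) (hβ : 0 ≤ β)
    (hnoise : ∀ a, |noise x r θ t a| ≤ α * pulls x t a + β)
    (hl : 0 < lambdaMin (design x t)) (u : E d) :
    |(inner ℝ u (score x r t θ) : ℝ)|
      ≤ (α * √t + β * Fintype.card 𝒳 / √(lambdaMin (design x t)))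
        * √(∑ s ∈ Finset.Icc 1 t, (inner ℝ (x s : E d) u : ℝ) ^ 2) := by
  set Q := ∑ s ∈ Finset.Icc 1 t, (inner ℝ (x s : E d) u : ℝ) ^ 2 with hQ
  have h1 : |(inner ℝ u (score x r t θ) : ℝ)|
      ≤ ∑ a : 𝒳, |(inner ℝ (a : E d) u : ℝ)| * (α * pulls x t a + β) := by
    rw [inner_score_eq_sum_noise]
    refine (Finset.abs_sum_le_sum_abs _ _).trans (Finset.sum_le_sum fun a _ => ?_)
    rw [abs_mul]
    exact mul_le_mul_of_nonneg_left (hnoise a) (abs_nonneg _)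
  have h2 : ∑ a : 𝒳, (pulls x t a : ℝ) * |(inner ℝ (a : E d) u : ℝ)| ≤ √t * √Q := by
    rw [← sum_comp_eq_sum_pulls x t (fun a => |(inner ℝ (a : E d) u : ℝ)|)]
    have := Real.sum_mul_le_sqrt_mul_sqrt (Finset.Icc 1 t) (fun _ => 1)
      (fun s => |(inner ℝ (x s : E d) u : ℝ)|)
    simpa [sq_abs] using this
  have h3 : ‖u‖ ≤ √Q / √(lambdaMin (design x t)) := by
    rw [le_div_iff₀ (Real.sqrt_pos.2 hl)]
    refine Real.le_sqrt_of_sq_le ?_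
    rw [mul_pow, Real.sq_sqrt hl.le, mul_comm]
    exact lambdaMin_design_mul_le x t u
  have h4 : ∑ a : 𝒳, |(inner ℝ (a : E d) u : ℝ)| ≤ Fintype.card 𝒳 * ‖u‖ := by
    refine (Finset.sum_le_sum fun a _ => abs_inner_arm_le hball a u).trans ?_
    simp
  have h5 : ∑ a : 𝒳, |(inner ℝ (a : E d) u : ℝ)| * (α * pulls x t a + β)
      = α * ∑ a : 𝒳, (pulls x t a : ℝ) * |(inner ℝ (a : E d) u : ℝ)|
        + β * ∑ a : 𝒳, |(inner ℝ (a : E d) u : ℝ)| := by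
    rw [Finset.mul_sum, Finset.mul_sum, ← Finset.sum_add_distrib]
    exact Finset.sum_congr rfl fun a _ => by ring
  calc _ ≤ _ := h1
    _ = _ := h5
    _ ≤ α * (√t * √Q) + β * (Fintype.card 𝒳 * (√Q / √(lambdaMin (design x t)))) := by
        gcongr
        exact h4.trans (by gcongr)
    _ = _ := by ring

/-- Strong consistency of the projected estimate. -/
lemma IsRun.tendsto_proj {d : ℕ} [NeZero d] {I : Type*} {𝒳 : Finset (E d)} {S : ℝ} (hS : 0 < S)
    {istar : E d → I} {x0 : Fin d → 𝒳} {x : ℕ → 𝒳} {r : ℕ → ℝ} {θhat θproj : ℕ → E d}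
    {w : ℕ → 𝒳 → ℝ} (hrun : IsRun 𝒳 S istar x0 x r θhat θproj w)
    (hball : ∀ a ∈ 𝒳, ‖a‖ ≤ 1) {θstar : E d} (hθ : θstar ∈ Theta d S)
    (h0 : 0 < lambdaMin (∑ i, outer (x0 i : E d))) {ρ : ℕ → ℝ} (hρ0 : ∀ t, 0 ≤ ρ t)
    (hρ : Tendsto ρ atTop (𝓝 0))
    (hnoise : ∀ᶠ t : ℕ in atTop, ∀ a, |noise x r θstar t a|
      ≤ ρ t / √√t * pulls x t a + ρ t * √t) :
    Tendsto θproj atTop (𝓝 θstar) := by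
  obtain ⟨m, hm0, hm1, hm⟩ := exists_le_dmu (by linarith : 0 ≤ S + 1)
  have hc := cX0_pos h0
  set b := cX0 x0 / 2 with hb
  have hb0 : 0 < b := by positivity
  set K : ℝ := 1 / √b + Fintype.card 𝒳 / b with hK
  have hK0 : 0 ≤ K := by positivity
  have hKρ : Tendsto (fun t => K * ρ t) atTop (𝓝 0) := by simpa using hρ.const_mul K
  rw [tendsto_iff_norm_sub_tendsto_zero]
  have hlim : Tendsto (fun t => 2 * (K * ρ t) / m ^ 2) atTop (𝓝 0) := by
    simpa using (hKρ.const_mul 2).div_const (m ^ 2)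
  refine squeeze_zero' (Eventually.of_forall fun t => norm_nonneg _) ?_ hlim
  filter_upwards [hnoise, hKρ.eventually_le_const hm0, eventually_ge_atTop 1,
    eventually_ge_atTop (2 * d)] with t hn hsmall ht1 ht2
  have hgrow := half_cX0_mul_sqrt_le_lambdaMin h0 hrun.forced ht2
  have ht0 : (0 : ℝ) < t := by exact_mod_cast ht1
  set q := √√(t : ℝ) with hq
  have hq0 : 0 < q := by positivity
  have hqq : √(t : ℝ) = q * q := (Real.mul_self_sqrt (Real.sqrt_nonneg _)).symm
  set l := lambdaMin (design x t)
  have hl : 0 < l := lt_of_lt_of_le (by positivity) hgrow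
  have hsl : √b * q ≤ √l := by
    rw [hq, ← Real.sqrt_mul hb0.le]
    exact Real.sqrt_le_sqrt hgrow
  have hsl0 : 0 < √b * q := by positivity
  have hbb : √b * √b = b := Real.mul_self_sqrt hb0.le
  set D := ρ t / q * √t + ρ t * √t * Fintype.card 𝒳 / √l with hD
  -- With `q = t^(1/4)` and `√l ≥ √b q`, both terms of `D` are at most a constant times `ρ t * √l`.
  have hDl : D ≤ K * ρ t * √l := by
    have e1 : ρ t / q * √t ≤ 1 / √b * ρ t * √l := by
      rw [hqq]
      calc ρ t / q * (q * q) = 1 / √b * ρ t * (√b * q) := by field_simp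
        _ ≤ _ := by have := hρ0 t; gcongr
    have e2 : ρ t * √t * Fintype.card 𝒳 / √l ≤ Fintype.card 𝒳 / b * ρ t * √l := by
      rw [div_le_iff₀ (hsl0.trans_le hsl), hqq]
      calc ρ t * (q * q) * Fintype.card 𝒳
          = Fintype.card 𝒳 / b * ρ t * ((√b * q) * (√b * q)) := by
            have : (√b * q) * (√b * q) = b * (q * q) := by linear_combination (q * q) * hbb
            rw [this]; field_simp
        _ ≤ Fintype.card 𝒳 / b * ρ t * (√l * √l) := by have := hρ0 t; gcongr
        _ = _ := by ring
    rw [hD, hK]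
    linarith
  have hD0 : 0 ≤ D := by have := hρ0 t; positivity
  have hmain := hrun.norm_proj_sub_le hball hθ hm0 hm1 hm ht1 hD0
    (abs_inner_score_le hball (by have := hρ0 t; positivity) (by have := hρ0 t; positivity) hn hl)
    hl (hDl.trans (by gcongr))
  rw [le_div_iff₀ (by positivity)]
  have h1 : m ^ 2 * (√l * ‖θproj t - θstar‖) ≤ 2 * (K * ρ t * √l) := by
    linarith
  have h2 : 0 < √l := hsl0.trans_le hsl
  refine le_of_mul_le_mul_right ?_ h2
  linarith

/-! ### Concentration of the noise -/

lemma noise_succ {d : ℕ} {𝒳 : Finset (E d)} (x : ℕ → 𝒳) (r : ℕ → ℝ) (θ : E d) (t : ℕ) (a : 𝒳)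
    [Decidable (x (t + 1) = a)] :
    noise x r θ (t + 1) a = noise x r θ t a
      + if x (t + 1) = a then r (t + 1) - Real.sigmoid (inner ℝ (a : E d) θ) else 0 := by
  unfold noise
  rw [Finset.sum_Icc_succ_top (by omega)]
  congr!

/-- Combines `exp l ≤ 1 + l + l²` for `|l| ≤ 1` with `1 + y ≤ exp y`; the left side is the mean of
`exp (l (r - p) - l²)` for a Bernoulli variable `r`. -/
lemma bernoulli_mgf_le {p l : ℝ} (hp0 : 0 ≤ p) (hp1 : p ≤ 1) (hl : |l| ≤ 1) :
    Real.exp (-(l * p) - l ^ 2) * (1 + p * (Real.exp l - 1)) ≤ 1 := by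
  have h1 : Real.exp l - 1 ≤ l + l ^ 2 := by
    linarith [(abs_le.1 (Real.abs_exp_sub_one_sub_id_le hl)).2]
  have h2 : 1 + p * (Real.exp l - 1) ≤ Real.exp (l * p + l ^ 2) := by
    refine le_trans ?_ (Real.add_one_le_exp _)
    nlinarith [sq_nonneg l]
  calc _ ≤ Real.exp (-(l * p) - l ^ 2) * Real.exp (l * p + l ^ 2) := by gcongr
    _ = 1 := by rw [← Real.exp_add]; simp

/-- The exponential supermartingale of the noise of arm `a`. -/
noncomputable def expNoise {d : ℕ} {Ω : Type*} {𝒳 : Finset (E d)} (θ : E d) (x : ℕ → Ω → 𝒳)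
    (r : ℕ → Ω → ℝ) (a : 𝒳) (l : ℝ) (t : ℕ) (ω : Ω) : ℝ :=
  Real.exp (l * noise (fun s => x s ω) (fun s => r s ω) θ t a
    - l ^ 2 * pulls (fun s => x s ω) t a)

open Classical in
-- For a binary reward `exp (l r)` is affine in `r`, so only the conditional mean of the reward will
-- matter.
lemma expNoise_succ {d : ℕ} {Ω : Type*} {𝒳 : Finset (E d)} (θ : E d) (x : ℕ → Ω → 𝒳)
    {r : ℕ → Ω → ℝ} (a : 𝒳) (l : ℝ) {t : ℕ} {ω : Ω} (h : r (t + 1) ω = 0 ∨ r (t + 1) ω = 1) :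
    expNoise θ x r a l (t + 1) ω = expNoise θ x r a l t ω
        * (if x (t + 1) ω = a
            then Real.exp (-(l * Real.sigmoid (inner ℝ (a : E d) θ)) - l ^ 2) else 1)
      + expNoise θ x r a l t ω
        * (if x (t + 1) ω = a
            then Real.exp (-(l * Real.sigmoid (inner ℝ (a : E d) θ)) - l ^ 2) * (Real.exp l - 1)
            else 0) * r (t + 1) ω := by
  unfold expNoise
  rw [noise_succ, pulls_succ]
  split_ifs with hx
  · set M := noise (fun s => x s ω) (fun s => r s ω) θ t a
    set p := Real.sigmoid (inner ℝ (a : E d) θ)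
    have h1 : Real.exp (l * r (t + 1) ω) = 1 + (Real.exp l - 1) * r (t + 1) ω := by
      rcases h with h0 | h0 <;> simp [h0]
    have h2 : l * (M + (r (t + 1) ω - p))
        - l ^ 2 * ((pulls (fun s => x s ω) t a + 1 : ℕ) : ℝ)
        = (l * M - l ^ 2 * pulls (fun s => x s ω) t a) + ((-(l * p) - l ^ 2) + l * r (t + 1) ω) := by
      push_cast; ring
    rw [h2, Real.exp_add, Real.exp_add (-(l * p) - l ^ 2), h1]
    ring
  · simp

section Supermartingale

variable {d : ℕ} {Ω : Type*} {mΩ : MeasurableSpace Ω} {P : Measure Ω} [IsProbabilityMeasure P]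
  {ℱ : Filtration ℕ mΩ} {𝒳 : Finset (E d)} {θ : E d} {x : ℕ → Ω → 𝒳} {r : ℕ → Ω → ℝ}

lemma IsLogisticBandit.expNoise_spec (h : IsLogisticBandit P ℱ 𝒳 θ x r) (a : 𝒳) {l : ℝ}
    (hl : |l| ≤ 1) (t : ℕ) :
    StronglyMeasurable[ℱ t] (expNoise θ x r a l t) ∧ Integrable (expNoise θ x r a l t) P ∧
      ∫ ω, expNoise θ x r a l t ω ∂P ≤ 1 := by
  classical
  induction t with
  | zero =>
    have : expNoise θ x r a l 0 = fun _ => 1 := by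
      funext ω
      simp [expNoise, noise, pulls]
    rw [this]
    exact ⟨stronglyMeasurable_const, integrable_const _, by simp⟩
  | succ t ih =>
    obtain ⟨hm, hi, hle⟩ := ih
    set Y := expNoise θ x r a l t with hY
    set p := Real.sigmoid (inner ℝ (a : E d) θ) with hp
    set c := Real.exp (-(l * p) - l ^ 2) with hc
    set κ := Real.exp l - 1 with hκ
    set U : Ω → ℝ := fun ω => if x (t + 1) ω = a then c else 1 with hU
    set V : Ω → ℝ := fun ω => if x (t + 1) ω = a then c * κ else 0 with hV
    have hset : MeasurableSet[ℱ t] {ω | x (t + 1) ω = a} :=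
      h.arm_meas t (measurableSet_singleton a)
    have hUm : StronglyMeasurable[ℱ t] U :=
      StronglyMeasurable.ite hset stronglyMeasurable_const stronglyMeasurable_const
    have hVm : StronglyMeasurable[ℱ t] V :=
      StronglyMeasurable.ite hset stronglyMeasurable_const stronglyMeasurable_const
    have hrm : StronglyMeasurable[ℱ (t + 1)] (r (t + 1)) := (h.reward_meas t).stronglyMeasurable
    have hle1 : ℱ t ≤ ℱ (t + 1) := ℱ.mono (Nat.le_succ t)
    have heq : expNoise θ x r a l (t + 1) = Y * U + Y * V * r (t + 1) := by
      funext ω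
      exact expNoise_succ θ x a l (h.reward_binary t ω)
    have hYU : Integrable (Y * U) P := by
      refine hi.mul_bdd (c := max |c| 1) (hUm.mono (ℱ.le t)).aestronglyMeasurable
        (Eventually.of_forall fun ω => ?_)
      simp only [hU, Real.norm_eq_abs]
      split_ifs <;> simp
    have hYV : Integrable (Y * V) P := by
      refine hi.mul_bdd (c := |c * κ|) (hVm.mono (ℱ.le t)).aestronglyMeasurable
        (Eventually.of_forall fun ω => ?_)
      simp only [hV, Real.norm_eq_abs]
      split_ifs
      · exact le_rfl
      · rw [abs_zero]; exact abs_nonneg _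
    have hr1 : ∀ ω, ‖r (t + 1) ω‖ ≤ 1 := fun ω => by
      rcases h.reward_binary t ω with h0 | h0 <;> simp [h0]
    have hrae : AEStronglyMeasurable (r (t + 1)) P := (hrm.mono (ℱ.le _)).aestronglyMeasurable
    have hri : Integrable (r (t + 1)) P :=
      Integrable.of_bound hrae 1 (Eventually.of_forall hr1)
    have hYVr : Integrable (Y * V * r (t + 1)) P :=
      hYV.mul_bdd (c := 1) hrae (Eventually.of_forall hr1)
    refine ⟨?_, ?_, ?_⟩
    · rw [heq]
      exact ((hm.mul hUm).mono hle1).add (((hm.mul hVm).mono hle1).mul hrm)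
    · rw [heq]
      exact hYU.add hYVr
    -- The factor `Y * V` is known after round `t`, so the reward may be replaced by its conditional
    -- mean under the integral.
    · have hcond : ∫ ω, (Y * V * r (t + 1)) ω ∂P
          = ∫ ω, (Y * V * P[r (t + 1) | ℱ t]) ω ∂P := by
        rw [← integral_condExp (ℱ.le t)]
        exact integral_congr_ae
          (condExp_mul_of_stronglyMeasurable_left (hm.mul hVm) hYVr hri)
      have hcondi : Integrable (Y * V * P[r (t + 1) | ℱ t]) P :=
        integrable_condExp.congr (condExp_mul_of_stronglyMeasurable_left (hm.mul hVm) hYVr hri)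
      rw [heq, integral_add' hYU hYVr, hcond, ← integral_add' hYU hcondi]
      refine le_trans (integral_mono_ae (hYU.add hcondi) hi ?_) hle
      filter_upwards [h.reward_law t] with ω hω
      simp only [Pi.add_apply, Pi.mul_apply, hω, hU, hV]
      have hY0 : 0 ≤ Y ω := (Real.exp_pos _).le
      split_ifs with hxa
      · rw [hxa]
        have := bernoulli_mgf_le (Real.sigmoid_nonneg (inner ℝ (a : E d) θ))
          (Real.sigmoid_le_one _) hl
        change c * (1 + p * κ) ≤ 1 at this
        change Y ω * c + Y ω * (c * κ) * p ≤ Y ω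
        calc Y ω * c + Y ω * (c * κ) * p = Y ω * (c * (1 + p * κ)) := by ring
          _ ≤ Y ω * 1 := by gcongr
          _ = Y ω := mul_one _
      · simp

lemma IsLogisticBandit.measure_expNoise_le (h : IsLogisticBandit P ℱ 𝒳 θ x r) (a : 𝒳) {l : ℝ}
    (hl : |l| ≤ 1) (t : ℕ) (c : ℝ) :
    P {ω | Real.exp c ≤ expNoise θ x r a l t ω} ≤ ENNReal.ofReal (Real.exp (-c)) := by
  obtain ⟨-, hi, hle⟩ := h.expNoise_spec a hl t
  have h1 := mul_meas_ge_le_integral_of_nonneg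
    (Eventually.of_forall fun ω => (Real.exp_pos _).le) hi (Real.exp c)
  rw [ENNReal.le_ofReal_iff_toReal_le (measure_ne_top _ _) (Real.exp_pos _).le, Real.exp_neg,
    ← one_div, le_div_iff₀ (Real.exp_pos c), mul_comm]
  exact h1.trans hle

/-- Markov's inequality at level `2 log (t + 1)` gives failure probability at most `(t + 1)⁻²`, and
Borel-Cantelli applies. Each bound concerns one fixed time, so `l` may vary with `t`. -/
lemma IsLogisticBandit.ae_eventually_noise_lt (h : IsLogisticBandit P ℱ 𝒳 θ x r) (a : 𝒳)
    (l : ℕ → ℝ) (hl : ∀ t, |l t| ≤ 1) :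
    ∀ᵐ ω ∂P, ∀ᶠ t : ℕ in atTop,
      l t * noise (fun s => x s ω) (fun s => r s ω) θ t a
        < l t ^ 2 * pulls (fun s => x s ω) t a + 2 * Real.log (t + 1) := by
  have hsum : ∑' t : ℕ, P {ω | Real.exp (2 * Real.log (t + 1)) ≤ expNoise θ x r a (l t) t ω}
      ≠ ⊤ := by
    have hs : Summable fun t : ℕ => 1 / ((t : ℝ) + 1) ^ 2 := by
      have := (summable_nat_add_iff 1).2 (Real.summable_one_div_nat_pow.2 one_lt_two)
      simpa using this
    refine ne_top_of_le_ne_top hs.tsum_ofReal_ne_top (ENNReal.tsum_le_tsum fun t => ?_)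
    refine (h.measure_expNoise_le a (hl t) t _).trans (ENNReal.ofReal_le_ofReal (le_of_eq ?_))
    have ht : (0 : ℝ) < t + 1 := by positivity
    rw [Real.exp_neg, mul_comm, Real.exp_mul, Real.exp_log ht, one_div]
    norm_cast
  filter_upwards [ae_eventually_notMem hsum] with ω hω
  filter_upwards [hω] with t ht
  have ht' := Real.exp_lt_exp.1 (not_le.1 ht)
  linarith

/-- The rate at which the noise of an arm is controlled. -/
noncomputable def noiseRate (t : ℕ) : ℝ := √(2 * Real.log (t + 1) / √√t)

lemma noiseRate_nonneg (t : ℕ) : 0 ≤ noiseRate t := Real.sqrt_nonneg _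

lemma tendsto_sqrt_sqrt_nat : Tendsto (fun t : ℕ => √√(t : ℝ)) atTop atTop :=
  Real.tendsto_sqrt_atTop.comp (Real.tendsto_sqrt_atTop.comp tendsto_natCast_atTop_atTop)

lemma tendsto_noiseRate : Tendsto noiseRate atTop (𝓝 0) := by
  have h1 : Tendsto (fun q : ℝ => 2 * (Real.log 2 + 4 * Real.log q) / q) atTop (𝓝 0) := by
    have h2 : Tendsto (fun q : ℝ => Real.log q / q) atTop (𝓝 0) :=
      Real.isLittleO_log_id_atTop.tendsto_div_nhds_zero
    have h3 : Tendsto (fun q : ℝ => 2 * Real.log 2 / q) atTop (𝓝 0) :=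
      tendsto_const_nhds.div_atTop tendsto_id
    have h4 := h3.add (h2.const_mul 8)
    rw [mul_zero, add_zero] at h4
    refine h4.congr fun q => ?_
    ring
  have h2 : Tendsto (fun t : ℕ => 2 * Real.log (t + 1) / √√(t : ℝ)) atTop (𝓝 0) := by
    refine squeeze_zero' ?_ ?_ (h1.comp tendsto_sqrt_sqrt_nat)
    · filter_upwards with t
      have : 0 ≤ Real.log ((t : ℝ) + 1) := Real.log_nonneg (by simp)
      positivity
    · filter_upwards [eventually_ge_atTop 1] with t ht
      have ht1 : (1 : ℝ) ≤ t := by exact_mod_cast ht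
      have e : √√(t : ℝ) ^ 4 = t := by
        rw [show √√(t : ℝ) ^ 4 = (√√(t : ℝ) ^ 2) ^ 2 by ring, Real.sq_sqrt (Real.sqrt_nonneg _),
          Real.sq_sqrt (by linarith)]
      have : Real.log ((t : ℝ) + 1) ≤ Real.log 2 + 4 * Real.log (√√(t : ℝ)) := by
        have e2 : Real.log 2 + 4 * Real.log (√√(t : ℝ)) = Real.log (2 * t) := by
          rw [Real.log_mul (by norm_num) (by linarith), ← e, Real.log_pow, e]
          norm_num
        rw [e2]
        exact Real.log_le_log (by linarith) (by linarith)
      simp only [Function.comp]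
      gcongr
  have h3 := (Real.continuous_sqrt.tendsto 0).comp h2
  rw [Real.sqrt_zero] at h3
  exact h3

lemma IsLogisticBandit.ae_eventually_abs_noise_le (h : IsLogisticBandit P ℱ 𝒳 θ x r) :
    ∀ᵐ ω ∂P, ∀ᶠ t : ℕ in atTop, ∀ a, |noise (fun s => x s ω) (fun s => r s ω) θ t a|
      ≤ noiseRate t / √√t * pulls (fun s => x s ω) t a + noiseRate t * √t := by
  set α : ℕ → ℝ := fun t => noiseRate t / √√(t : ℝ) with hα
  have hα0 : ∀ t, 0 ≤ α t := fun t => div_nonneg (noiseRate_nonneg t) (Real.sqrt_nonneg _)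
  -- The cap at `1` only secures `|l t| ≤ 1` for all `t`; eventually it is inactive.
  set l : ℕ → ℝ := fun t => min (α t) 1 with hl
  have hl1 : ∀ t, |l t| ≤ 1 := fun t => by
    rw [abs_of_nonneg (le_min (hα0 t) zero_le_one)]
    exact min_le_right _ _
  have hall : ∀ᵐ ω ∂P, ∀ a : 𝒳, (∀ᶠ t : ℕ in atTop,
      l t * noise (fun s => x s ω) (fun s => r s ω) θ t a
        < l t ^ 2 * pulls (fun s => x s ω) t a + 2 * Real.log (t + 1)) ∧
      (∀ᶠ t : ℕ in atTop,
      -l t * noise (fun s => x s ω) (fun s => r s ω) θ t a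
        < (-l t) ^ 2 * pulls (fun s => x s ω) t a + 2 * Real.log (t + 1)) := by
    rw [ae_all_iff]
    intro a
    filter_upwards [h.ae_eventually_noise_lt a l hl1,
      h.ae_eventually_noise_lt a (fun t => -l t) (fun t => by rw [abs_neg]; exact hl1 t)]
      with ω h1 h2
    exact ⟨h1, h2⟩
  filter_upwards [hall] with ω hω
  rw [eventually_all]
  intro a
  filter_upwards [(hω a).1, (hω a).2, tendsto_sqrt_sqrt_nat.eventually_ge_atTop 1,
    tendsto_noiseRate.eventually_le_const zero_lt_one, eventually_ge_atTop 1] with t h1 h2 hq hρ ht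
  have ht1 : (1 : ℝ) ≤ t := by exact_mod_cast ht
  set M := noise (fun s => x s ω) (fun s => r s ω) θ t a
  set N := (pulls (fun s => x s ω) t a : ℝ)
  set q := √√(t : ℝ) with hqd
  have hlog : 0 < Real.log ((t : ℝ) + 1) := Real.log_pos (by linarith)
  have hq0 : 0 < q := by linarith
  have hsq : noiseRate t ^ 2 * q = 2 * Real.log (t + 1) := by
    rw [noiseRate, Real.sq_sqrt (by positivity), ← hqd, div_mul_cancel₀ _ hq0.ne']
  have hqq : √(t : ℝ) = q * q := (Real.mul_self_sqrt (Real.sqrt_nonneg _)).symm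
  have hαt : α t = noiseRate t / q := rfl
  have hlt : l t = α t := by
    refine min_eq_left ?_
    rw [hαt, div_le_one hq0]
    linarith
  have hpos : 0 < α t := by
    rw [hαt]
    refine div_pos ?_ hq0
    rw [noiseRate]
    exact Real.sqrt_pos.2 (by positivity)
  -- This identity dictates the choice of `noiseRate`: dividing the deviation bound by `α t` leaves
  -- exactly the offset `noiseRate t * √t`.
  have hαβ : 2 * Real.log ((t : ℝ) + 1) = α t * (noiseRate t * √t) := by
    rw [← hsq, hαt, hqq]
    field_simp
  rw [hlt, hαβ] at h1 h2
  rw [← hαt]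
  refine abs_le.2 ⟨?_, ?_⟩
  · have : α t * (-M) ≤ α t * (α t * N + noiseRate t * √t) := by nlinarith
    linarith [le_of_mul_le_mul_left this hpos]
  · have : α t * M ≤ α t * (α t * N + noiseRate t * √t) := by nlinarith
    exact le_of_mul_le_mul_left this hpos

end Supermartingale

/-! ### Growth of the stopping statistic -/

/-- The contribution of arm `a` to `½ ‖θ - λ‖²_{H_w(θ)}`. -/
noncomputable def armCost {d : ℕ} (a θ lam : E d) : ℝ :=
  1 / 2 * (dmu (inner ℝ a θ) * (inner ℝ a (θ - lam) : ℝ) ^ 2)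

lemma half_sqNorm_HW {d : ℕ} (𝒳 : Finset (E d)) (w : 𝒳 → ℝ) (θ lam : E d) :
    1 / 2 * sqNorm (HW 𝒳 w θ) (θ - lam) = ∑ a : 𝒳, w a * armCost (a : E d) θ lam := by
  rw [sqNorm_HW, Finset.mul_sum]
  exact Finset.sum_congr rfl fun a _ => by rw [armCost]; ring

lemma half_sqNorm_fisher {d : ℕ} {𝒳 : Finset (E d)} (x : ℕ → 𝒳) (t : ℕ) (θ lam : E d) :
    1 / 2 * sqNorm (fisher x t θ) (θ - lam)
      = ∑ a : 𝒳, pulls x t a * armCost (a : E d) θ lam := by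
  rw [sqNorm_fisher, Finset.mul_sum]
  exact sum_comp_eq_sum_pulls x t fun a : 𝒳 => armCost (a : E d) θ lam

lemma armCost_nonneg {d : ℕ} (a θ lam : E d) : 0 ≤ armCost a θ lam := by
  have := (dmu_pos (inner ℝ a θ)).le
  unfold armCost
  positivity

lemma armCost_le {d : ℕ} {𝒳 : Finset (E d)} (hball : ∀ a ∈ 𝒳, ‖a‖ ≤ 1) (a : 𝒳) (θ lam : E d) :
    armCost (a : E d) θ lam ≤ 1 / 2 * ‖θ - lam‖ ^ 2 := by
  unfold armCost
  gcongr
  have h1 : (inner ℝ (a : E d) (θ - lam) : ℝ) ^ 2 ≤ ‖θ - lam‖ ^ 2 :=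
    sq_le_sq.2 (by rw [abs_norm]; exact abs_inner_arm_le hball a _)
  exact (mul_le_of_le_one_left (sq_nonneg _) (dmu_le_one _)).trans h1

lemma armCost_le_of_mem_Theta {d : ℕ} {𝒳 : Finset (E d)} (hball : ∀ a ∈ 𝒳, ‖a‖ ≤ 1) (a : 𝒳)
    {S : ℝ} {θ lam : E d} (hθ : θ ∈ Theta d S) (hlam : lam ∈ Theta d S) :
    armCost (a : E d) θ lam ≤ 2 * S ^ 2 := by
  have h1 : ‖θ‖ ≤ S := hθ
  have h2 : ‖lam‖ ≤ S := hlam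
  have h3 : ‖θ - lam‖ ≤ 2 * S := (norm_sub_le _ _).trans (by linarith)
  have h4 : ‖θ - lam‖ ^ 2 ≤ (2 * S) ^ 2 := by gcongr
  linarith [armCost_le hball a θ lam]

lemma continuous_armCost {d : ℕ} (a : E d) :
    Continuous fun z : E d × E d => armCost a z.1 z.2 := by
  unfold armCost
  have := continuous_dmu
  fun_prop

/-- Uniform continuity on the compact set `Θ × Θ` makes the approximation uniform in the
alternative. -/
lemma eventually_abs_armCost_sub_le {d : ℕ} (𝒳 : Finset (E d)) {S : ℝ} {θ : ℕ → E d}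
    {θstar : E d} (hθ : ∀ t, 1 ≤ t → θ t ∈ Theta d S) (hθstar : θstar ∈ Theta d S)
    (hlim : Tendsto θ atTop (𝓝 θstar)) {ε : ℝ} (hε : 0 < ε) :
    ∀ᶠ t in atTop, ∀ a : 𝒳, ∀ lam ∈ Theta d S,
      |armCost (a : E d) (θ t) lam - armCost (a : E d) θstar lam| ≤ ε := by
  rw [eventually_all]
  intro a
  have hball : Theta d S = Metric.closedBall 0 S := by
    ext v
    simp [Theta]
  have hK : IsCompact (Theta d S ×ˢ Theta d S) := by
    rw [hball]
    exact (isCompact_closedBall _ _).prod (isCompact_closedBall _ _)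
  obtain ⟨η, hη, h⟩ := Metric.uniformContinuousOn_iff.1
    (hK.uniformContinuousOn_of_continuous (continuous_armCost (a : E d)).continuousOn) ε hε
  filter_upwards [Metric.tendsto_nhds.1 hlim η hη, eventually_ge_atTop 1] with t ht ht1 lam hlam
  have := h (θ t, lam) ⟨hθ t ht1, hlam⟩ (θstar, lam) ⟨hθstar, hlam⟩ (by
    rw [Prod.dist_eq, dist_self]
    exact max_lt ht hη)
  exact (Real.dist_eq _ _ ▸ this).le

lemma sum_weight_sub_le {ι : Type*} [Fintype ι] {w : ι → ℝ} {f g : ι → ℝ} {ε n : ℝ}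
    (hw : ∀ i, 0 ≤ w i) (hs : ∑ i, w i = n) (h : ∀ i, |f i - g i| ≤ ε) :
    ∑ i, w i * g i - n * ε ≤ ∑ i, w i * f i := by
  rw [← hs, Finset.sum_mul, ← Finset.sum_sub_distrib]
  refine Finset.sum_le_sum fun i _ => ?_
  nlinarith [hw i, (abs_le.1 (h i)).1]

lemma ofReal_le_psi_iff {d : ℕ} {I : Type*} {𝒳 : Finset (E d)} {S : ℝ} {istar : E d → I}
    {θ : E d} {w : 𝒳 → ℝ} {p : ℝ} (hp : 0 < p) :
    ENNReal.ofReal p ≤ psi 𝒳 S istar θ w ↔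
      ∀ lam ∈ Alt S istar θ, p ≤ ∑ a : 𝒳, w a * armCost (a : E d) θ lam := by
  simp only [psi, le_iInf_iff, half_sqNorm_HW]
  refine forall₂_congr fun lam _ => ⟨fun h => ?_, fun h => ENNReal.ofReal_le_ofReal h⟩
  exact (ENNReal.ofReal_le_ofReal_iff' .. |>.1 h).resolve_right (not_le.2 hp)

lemma exists_ofReal_le_psi {d : ℕ} {I : Type*} {𝒳 : Finset (E d)} {S : ℝ} {istar : E d → I}
    {θ : E d} (h : psiStar 𝒳 S istar θ ≠ 0) :
    ∃ w ∈ stdSimplex ℝ 𝒳, ∃ p : ℝ, 0 < p ∧ ENNReal.ofReal p ≤ psi 𝒳 S istar θ w := by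
  have h1 : ∃ w ∈ stdSimplex ℝ 𝒳, psi 𝒳 S istar θ w ≠ 0 := by
    by_contra! hcon
    exact h (by simpa [psiStar] using hcon)
  obtain ⟨w, hw, hne⟩ := h1
  -- Truncation at `1` is needed because `psi` is infinite when there is no alternative.
  have hmin : min (psi 𝒳 S istar θ w) 1 ≠ ⊤ :=
    ne_top_of_le_ne_top ENNReal.one_ne_top (min_le_right _ _)
  refine ⟨w, hw, (min (psi 𝒳 S istar θ w) 1).toReal, ENNReal.toReal_pos ?_ hmin, ?_⟩
  · exact (lt_min (pos_iff_ne_zero.2 hne) zero_lt_one).ne'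
  · rw [ENNReal.ofReal_toReal hmin]
    exact min_le_left _ _

lemma cumWeight_sum_mul {d : ℕ} {𝒳 : Finset (E d)} (w : ℕ → 𝒳 → ℝ) (t : ℕ) (f : 𝒳 → ℝ) :
    ∑ a, cumWeight w t a * f a = ∑ s ∈ Finset.Icc 1 t, ∑ a, w s a * f a := by
  simp only [cumWeight, Finset.sum_mul]
  exact Finset.sum_comm

/-- Every late weight vector, being optimal for an estimate near `θ*`, does nearly as well as one
fixed good vector `w0`. Hence neither continuity nor uniqueness of the optimal weights is required.
-/
lemma IsRun.eventually_le_Z {d : ℕ} [NeZero d] {I : Type*} {𝒳 : Finset (E d)} {S : ℝ}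
    {istar : E d → I} {x0 : Fin d → 𝒳} {x : ℕ → 𝒳} {r : ℕ → ℝ} {θhat θproj : ℕ → E d}
    {w : ℕ → 𝒳 → ℝ} (hrun : IsRun 𝒳 S istar x0 x r θhat θproj w)
    (hball : ∀ a ∈ 𝒳, ‖a‖ ≤ 1) {θstar : E d} (hθ : θstar ∈ Theta d S)
    (h0 : 0 < lambdaMin (∑ i, outer (x0 i : E d)))
    (hlim : Tendsto θproj atTop (𝓝 θstar)) (hpsi : psiStar 𝒳 S istar θstar ≠ 0) :
    ∃ k : ℝ, 0 < k ∧ ∀ᶠ t : ℕ in atTop, ENNReal.ofReal (k * t) ≤ Z S istar x θproj t := by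
  have hw : ∀ t, 1 ≤ t → w t ∈ stdSimplex ℝ 𝒳 := fun t ht => (hrun.weights t ht).1
  obtain ⟨w0, hw0, p, hp, hpw⟩ := exists_ofReal_le_psi hpsi
  rw [ofReal_le_psi_iff hp] at hpw
  have hfar : ∀ lam ∈ Alt S istar θstar, 2 * p ≤ ‖θstar - lam‖ ^ 2 := by
    intro lam hlam
    have h1 : ∑ a : 𝒳, w0 a * armCost (a : E d) θstar lam
        ≤ ∑ a : 𝒳, w0 a * (1 / 2 * ‖θstar - lam‖ ^ 2) :=
      Finset.sum_le_sum fun a _ => mul_le_mul_of_nonneg_left (armCost_le hball a _ _) (hw0.1 a)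
    rw [← Finset.sum_mul, hw0.2, one_mul] at h1
    linarith [hpw lam hlam]
  -- An estimate with another answer would itself be an alternative to `θ*`, and `hfar` excludes
  -- those near `θ*`. This replaces any regularity assumption on `istar`.
  have hAlt : ∀ᶠ t in atTop, Alt S istar (θproj t) = Alt S istar θstar := by
    have h1 : Tendsto (fun t => ‖θstar - θproj t‖ ^ 2) atTop (𝓝 0) := by
      have := ((tendsto_const_nhds (x := θstar)).sub hlim).norm.pow 2
      simpa using this
    filter_upwards [h1.eventually_lt_const (by linarith : 0 < 2 * p), eventually_ge_atTop 1]
      with t ht ht1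
    have h2 : istar (θproj t) = istar θstar := by
      by_contra hne
      exact absurd (hfar _ ⟨hrun.proj_mem t ht1, hne⟩) (not_le.2 ht)
    simp only [Alt, h2]
  have hclose := eventually_abs_armCost_sub_le 𝒳 hrun.proj_mem hθ hlim
    (by positivity : 0 < p / 8)
  obtain ⟨T, hT⟩ := eventually_atTop.1 ((hAlt.and hclose).and (eventually_ge_atTop 1))
  set n : ℝ := ((Fintype.card 𝒳 : ℕ) : ℝ)
  -- every late weight vector has a large cost against each alternative
  have hlate : ∀ s, T ≤ s → ∀ lam ∈ Alt S istar θstar,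
      p / 4 * 3 ≤ ∑ a : 𝒳, w s a * armCost (a : E d) θstar lam := by
    intro s hs
    obtain ⟨⟨hA, hcl⟩, hs1⟩ := hT s hs
    have h1 : ENNReal.ofReal (p - p / 8) ≤ psi 𝒳 S istar (θproj s) (w s) := by
      refine le_trans ?_ ((hrun.weights s hs1).2 w0 hw0)
      rw [ofReal_le_psi_iff (by linarith), hA]
      intro lam hlam
      have := sum_weight_sub_le hw0.1 hw0.2 (fun a => hcl a lam hlam.1)
      linarith [hpw lam hlam]
    rw [ofReal_le_psi_iff (by linarith), hA] at h1
    intro lam hlam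
    have := sum_weight_sub_le (hw s hs1).1 (hw s hs1).2
      (fun a => (abs_sub_comm _ _).trans_le (hcl a lam hlam.1))
    linarith [h1 lam hlam]
  -- The sum runs over `n` arms, each with tracking deficit at most `n * (1 + k)` for forced count
  -- `k` and cost at most `2 * S ^ 2`.
  set C : ℝ := n * (n * (2 * S ^ 2)) with hC
  have hC0 : 0 ≤ C := by positivity
  have hev : ∀ᶠ t : ℕ in atTop, p * T + C * (1 + (√d * √t + d + 1)) ≤ p / 4 * t := by
    have e1 : Tendsto (fun t : ℕ => √(t : ℝ)) atTop atTop :=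
      Real.tendsto_sqrt_atTop.comp tendsto_natCast_atTop_atTop
    set K1 := p * T + C * (d + 2)
    set K2 := C * √d
    filter_upwards [e1.eventually_ge_atTop (4 / p * (|K1| + K2)), e1.eventually_ge_atTop 1]
      with t ht1 ht2
    have e2 : √(t : ℝ) * √t = t := Real.mul_self_sqrt (Nat.cast_nonneg _)
    have e3 : |K1| ≤ |K1| * √t := le_mul_of_one_le_right (abs_nonneg _) ht2
    have e4 : p / 4 * (4 / p * (|K1| + K2)) ≤ p / 4 * √t := by gcongr
    have e5 : p / 4 * (4 / p * (|K1| + K2)) = |K1| + K2 := by field_simp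
    have e6 : (|K1| + K2) * √t ≤ p / 4 * √t * √t := by rw [← e5]; gcongr
    calc p * T + C * (1 + (√d * √t + d + 1)) = K1 + K2 * √t := by simp only [K1, K2]; ring
      _ ≤ |K1| * √t + K2 * √t := by linarith [le_abs_self K1]
      _ = (|K1| + K2) * √t := by ring
      _ ≤ p / 4 * √t * √t := e6
      _ = p / 4 * t := by rw [mul_assoc, e2]
  refine ⟨p / 4, by positivity, ?_⟩
  filter_upwards [hev, eventually_ge_atTop T] with t hbig htT
  obtain ⟨⟨hA, hcl⟩, ht1⟩ := hT t htT
  have hT1 : 1 ≤ T := (hT T le_rfl).2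
  unfold Z
  rw [hA]
  refine le_iInf₂ fun lam hlam => ENNReal.ofReal_le_ofReal ?_
  rw [half_sqNorm_fisher]
  have h1 := sum_weight_sub_le (fun a => Nat.cast_nonneg (pulls x t a)) (sum_pulls x t)
    (fun a => hcl a lam hlam.1)
  have hk := forcedCount_le h0 hrun.forced t
  set k : ℝ := ((forcedCount x0 x t : ℕ) : ℝ) with hkd
  have h2 : ∑ a : 𝒳, cumWeight w t a * armCost (a : E d) θstar lam - C * (1 + k)
      ≤ ∑ a : 𝒳, (pulls x t a : ℝ) * armCost (a : E d) θstar lam := by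
    have e1 : ∑ a : 𝒳, cumWeight w t a * armCost (a : E d) θstar lam
        ≤ ∑ a : 𝒳, ((pulls x t a : ℝ) * armCost (a : E d) θstar lam
          + n * (1 + k) * (2 * S ^ 2)) := by
      refine Finset.sum_le_sum fun a _ => ?_
      have e2 := cumWeight_le_pulls_add hw hrun.tracking ht1 a
      have e3 := mul_le_mul_of_nonneg_right e2 (armCost_nonneg (a : E d) θstar lam)
      have e4 : n * (1 + k) * armCost (a : E d) θstar lam ≤ n * (1 + k) * (2 * S ^ 2) :=
        mul_le_mul_of_nonneg_left (armCost_le_of_mem_Theta hball a hθ hlam.1) (by positivity)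
      linarith
    rw [Finset.sum_add_distrib, Finset.sum_const, Finset.card_univ, nsmul_eq_mul] at e1
    rw [hC]
    linarith
  have h3 : (t - T : ℝ) * (p / 4 * 3)
      ≤ ∑ a : 𝒳, cumWeight w t a * armCost (a : E d) θstar lam := by
    rw [cumWeight_sum_mul]
    have e1 : ∑ _s ∈ Finset.Icc T t, p / 4 * 3
        ≤ ∑ s ∈ Finset.Icc 1 t, ∑ a : 𝒳, w s a * armCost (a : E d) θstar lam := by
      refine (Finset.sum_le_sum fun s hs => hlate s (Finset.mem_Icc.1 hs).1 lam hlam).trans ?_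
      refine Finset.sum_le_sum_of_subset_of_nonneg (Finset.Icc_subset_Icc_left hT1) fun s hs _ => ?_
      exact Finset.sum_nonneg fun a _ =>
        mul_nonneg ((hw s (Finset.mem_Icc.1 hs).1).1 a) (armCost_nonneg _ _ _)
    rw [Finset.sum_const, Nat.card_Icc, nsmul_eq_mul, Nat.cast_sub (by omega)] at e1
    push_cast at e1
    nlinarith
  have h4 : C * (1 + k) ≤ C * (1 + (√d * √t + d + 1)) := by gcongr
  have hTp : (0 : ℝ) ≤ p * T := by positivity
  have htp : (0 : ℝ) ≤ p * t := by positivity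
  linarith

/-! ### The stopping time -/

lemma tendsto_log_div_sqrt : Tendsto (fun t : ℕ => Real.log t / √(t : ℝ)) atTop (𝓝 0) := by
  have h := (isLittleO_log_rpow_atTop (show (0 : ℝ) < 1 / 2 by norm_num)).tendsto_div_nhds_zero
  refine (h.comp tendsto_natCast_atTop_atTop).congr fun t => ?_
  simp [Real.sqrt_eq_rpow]

lemma tendsto_sqrt_nat : Tendsto (fun t : ℕ => √(t : ℝ)) atTop atTop :=
  Real.tendsto_sqrt_atTop.comp tendsto_natCast_atTop_atTop

lemma tendsto_log_nat : Tendsto (fun t : ℕ => Real.log (t : ℝ)) atTop atTop :=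
  Real.tendsto_log_atTop.comp tendsto_natCast_atTop_atTop

lemma IsRun.eventually_mem_B {d : ℕ} [NeZero d] {I : Type*} {𝒳 : Finset (E d)} {S : ℝ}
    {istar : E d → I} {x0 : Fin d → 𝒳} {x : ℕ → 𝒳} {r : ℕ → ℝ} {θhat θproj : ℕ → E d}
    {w : ℕ → 𝒳 → ℝ} (hrun : IsRun 𝒳 S istar x0 x r θhat θproj w)
    (h0 : 0 < lambdaMin (∑ i, outer (x0 i : E d))) (θ : E d) (c : ℝ) :
    ∀ᶠ t in atTop, t ∈ B θ (fun t => c * Real.log t) x := by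
  have hb : 0 < cX0 x0 / 2 := half_pos (cX0_pos h0)
  have hlim := (tendsto_log_div_sqrt.const_mul (kappa 𝒳 θ * c))
  rw [mul_zero] at hlim
  obtain ⟨T, hT⟩ := eventually_atTop.1
    ((hlim.eventually_lt_const hb).and (tendsto_sqrt_nat.eventually_gt_atTop 0))
  filter_upwards [eventually_ge_atTop T, eventually_ge_atTop 1, eventually_ge_atTop (2 * d)]
    with t h1 h2 h3
  refine ⟨h2, fun s hs => ?_⟩
  obtain ⟨h4, h5⟩ := hT s (h1.trans hs)
  refine lt_of_lt_of_le ?_ (half_cX0_mul_sqrt_le_lambdaMin h0 hrun.forced (h3.trans hs))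
  rw [← mul_div_assoc, div_lt_iff₀ h5] at h4
  linarith

lemma eventually_abs_log_ratio_le {c L D : ℝ} (hc : 0 < c) (hL : 0 < L) (hD : 0 < D) :
    ∀ᶠ t : ℕ in atTop, |Real.log (L * t / (c * Real.log t * D))|
      ≤ |Real.log L| + |Real.log c| + |Real.log D| + 2 * Real.log t := by
  filter_upwards [tendsto_log_nat.eventually_ge_atTop 1, eventually_ge_atTop 1] with t h1 h2
  have ht : (0 : ℝ) < t := by exact_mod_cast h2
  have hl : 0 < Real.log (t : ℝ) := by linarith
  have h3 : Real.log (L * t / (c * Real.log t * D)) = Real.log L + Real.log t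
      - (Real.log c + Real.log (Real.log t) + Real.log D) := by
    rw [Real.log_div (by positivity) (by positivity), Real.log_mul hL.ne' ht.ne',
      Real.log_mul (by positivity) hD.ne', Real.log_mul hc.ne' hl.ne']
  have h4 : 0 ≤ Real.log (Real.log t) := Real.log_nonneg h1
  have h5 : Real.log (Real.log t) ≤ Real.log t := Real.log_le_self hl.le
  rw [h3, abs_le]
  constructor <;> linarith [le_abs_self (Real.log L), neg_abs_le (Real.log L),
    le_abs_self (Real.log c), neg_abs_le (Real.log c), le_abs_self (Real.log D),
    neg_abs_le (Real.log D)]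

/-- The logarithm in `γ_t` is `O(√t)` with a constant governed by `K`, and its factor `4 / √λ(t)`
tends to `0`, which beats any `K`; the remaining `√λ(t) / 2` is `o(√t)`. -/
lemma eventually_abs_gammaT_le (d : ℕ) [NeZero d] {c L K ε : ℝ} (hc : 0 < c) (hL : 0 < L)
    (hε : 0 < ε) :
    ∀ᶠ t : ℕ in atTop, ∀ δ : ℝ, 0 < δ → δ < 1 → Real.log (1 / δ) ≤ K * √t →
      |gammaT d L (c * Real.log t) t δ| ≤ ε * √t := by
  have hd : (0 : ℝ) < d := by exact_mod_cast Nat.pos_of_neZero d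
  set C := d * Real.log 2 + d / 2 * (|Real.log L| + |Real.log c| + |Real.log (d : ℝ)|) with hC
  have hinv : Tendsto (fun t : ℕ => (√(t : ℝ))⁻¹) atTop (𝓝 0) :=
    tendsto_inv_atTop_zero.comp tendsto_sqrt_nat
  have hl : Tendsto (fun t : ℕ => 4 / √(c * Real.log t)) atTop (𝓝 0) :=
    tendsto_const_nhds.div_atTop
      (Real.tendsto_sqrt_atTop.comp (tendsto_log_nat.const_mul_atTop hc))
  have h1 : Tendsto (fun t : ℕ => K + C * (√(t : ℝ))⁻¹ + d * (Real.log t / √t)) atTop (𝓝 K) := by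
    simpa using (tendsto_const_nhds (x := K)).add (hinv.const_mul C) |>.add
      (tendsto_log_div_sqrt.const_mul (d : ℝ))
  have h2 : Tendsto (fun t : ℕ => √(c * (Real.log t / √t)) * √((√(t : ℝ))⁻¹) / 2)
      atTop (𝓝 0) := by
    have e1 := (Real.continuous_sqrt.tendsto _).comp (tendsto_log_div_sqrt.const_mul c)
    have e2 := (Real.continuous_sqrt.tendsto _).comp hinv
    simpa using (e1.mul e2).div_const 2
  have h3 := h2.add (hl.mul h1)
  rw [zero_mul, add_zero] at h3
  filter_upwards [h3.eventually_le_const hε, eventually_abs_log_ratio_le hc hL hd,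
    tendsto_sqrt_nat.eventually_gt_atTop 0, tendsto_log_nat.eventually_gt_atTop 0]
    with t hle hratio hs hlog δ hδ0 hδ1 hδ
  have ht : (0 : ℝ) < t := Real.sqrt_pos.1 hs
  set l := c * Real.log (t : ℝ) with hldef
  have hl0 : 0 < l := by positivity
  set X := L * t / (l * d) with hX
  have hX0 : 0 < X := by positivity
  have hexp : Real.log (2 ^ d / δ * X ^ ((d : ℝ) / 2))
      = d * Real.log 2 + Real.log (1 / δ) + d / 2 * Real.log X := by
    rw [Real.log_mul (by positivity) (by positivity), Real.log_rpow hX0,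
      Real.log_div (by positivity) hδ0.ne', Real.log_pow, one_div, Real.log_inv]
    ring
  have hlδ : 0 ≤ Real.log (1 / δ) := Real.log_nonneg (by rw [le_div_iff₀ hδ0]; linarith)
  have hbig : |d * Real.log 2 + Real.log (1 / δ) + d / 2 * Real.log X|
      ≤ (K + C * (√(t : ℝ))⁻¹ + d * (Real.log t / √t)) * √t := by
    have e1 : (K + C * (√(t : ℝ))⁻¹ + d * (Real.log t / √t)) * √t
        = K * √t + C + d * Real.log t := by field_simp
    have e2 : |d / 2 * Real.log X| ≤ d / 2 * (|Real.log L| + |Real.log c| + |Real.log (d : ℝ)|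
        + 2 * Real.log t) := by
      rw [abs_mul, abs_of_pos (by positivity : (0 : ℝ) < d / 2)]
      gcongr
    have e3 : 0 ≤ d * Real.log 2 := by
      have := Real.log_pos one_lt_two
      positivity
    rw [e1, hC]
    have e4 := abs_le.1 e2
    rw [abs_le]
    constructor <;> linarith
  have hsqrt : √l / 2 = √(c * (Real.log t / √t)) * √((√(t : ℝ))⁻¹) / 2 * √t := by
    have e1 : √(c * (Real.log t / √t)) * √((√(t : ℝ))⁻¹) * √t = √l := by
      rw [← Real.sqrt_mul (by positivity), ← Real.sqrt_mul (by positivity)]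
      congr 1
      field_simp
      rw [Real.sq_sqrt ht.le, hldef, mul_comm]
    rw [← e1]
    ring
  unfold gammaT
  rw [hexp]
  calc |√l / 2 + 4 / √l * (d * Real.log 2 + Real.log (1 / δ) + d / 2 * Real.log X)|
      ≤ √l / 2 + 4 / √l * |d * Real.log 2 + Real.log (1 / δ) + d / 2 * Real.log X| := by
        refine (abs_add_le _ _).trans (le_of_eq ?_)
        rw [abs_mul, abs_of_nonneg (by positivity : 0 ≤ √l / 2),
          abs_of_nonneg (by positivity : 0 ≤ 4 / √l)]
    _ ≤ √l / 2 + 4 / √l * ((K + C * (√(t : ℝ))⁻¹ + d * (Real.log t / √t)) * √t) := by gcongr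
    _ = (√(c * (Real.log t / √t)) * √((√(t : ℝ))⁻¹) / 2
          + 4 / √l * (K + C * (√(t : ℝ))⁻¹ + d * (Real.log t / √t))) * √t := by
        rw [hsqrt]; ring
    _ ≤ ε * √t := by gcongr

/-- The threshold at a time of order at least `log(1/δ)²` is sublinear in the time. -/
lemma eventually_beta_lt (d : ℕ) [NeZero d] {S c L K k : ℝ} (hS : 0 < S) (hc : 0 < c) (hL : 0 < L)
    (hk : 0 < k) :
    ∀ᶠ t : ℕ in atTop, ∀ δ : ℝ, 0 < δ → δ < 1 → Real.log (1 / δ) ≤ K * √t →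
      beta d S L (c * Real.log t) δ t < ENNReal.ofReal (k * t) := by
  set ε := √(k / 4) / (1 + 2 * S) with hε
  have hε0 : 0 < ε := by positivity
  filter_upwards [eventually_abs_gammaT_le d (K := K) hc hL hε0, eventually_ge_atTop 1,
    tendsto_log_nat.eventually_gt_atTop 0] with t ht ht1 hlog δ h1 h2 h3
  have ht0 : (0 : ℝ) < t := by exact_mod_cast ht1
  rw [beta, if_pos (by positivity)]
  refine (ENNReal.ofReal_lt_ofReal_iff (by positivity)).2 ?_
  have h4 := ht δ h1 h2 h3
  set γ := gammaT d L (c * Real.log t) t δ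
  have h5 : γ ^ 2 ≤ (ε * √t) ^ 2 := sq_le_sq.2 (h4.trans (le_abs_self _))
  have h6 : (1 + 2 * S) ^ 2 * ε ^ 2 = k / 4 := by
    rw [hε, div_pow, Real.sq_sqrt (by positivity)]
    field_simp
  rw [mul_pow, Real.sq_sqrt ht0.le] at h5
  have h7 : (1 + 2 * S) ^ 2 * γ ^ 2 ≤ (1 + 2 * S) ^ 2 * (ε ^ 2 * t) := by gcongr
  rw [mul_pow]
  nlinarith [mul_pos hk ht0]

lemma tendsto_log_one_div : Tendsto (fun δ : ℝ => Real.log (1 / δ)) (𝓝[>] 0) atTop := by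
  simp only [one_div]
  exact Real.tendsto_log_atTop.comp tendsto_inv_nhdsGT_zero

lemma limsup_tau_eq_zero {d : ℕ} [NeZero d] {I : Type*} {𝒳 : Finset (E d)} {S : ℝ} (hS : 0 < S)
    {istar : E d → I} {x : ℕ → 𝒳} {θproj : ℕ → E d} {θstar : E d} {c L k : ℝ} (hc : 0 < c)
    (hL : 0 < L) (hk : 0 < k)
    (hZ : ∀ᶠ t : ℕ in atTop, ENNReal.ofReal (k * t) ≤ Z S istar x θproj t)
    (hB : ∀ᶠ t in atTop, t ∈ B θstar (fun t => c * Real.log t) x) :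
    limsup (fun δ : ℝ =>
          ((tau S L istar θstar (fun t => c * Real.log t) x θproj δ : ℕ∞) : ℝ≥0∞)
            / ENNReal.ofReal (Real.log (1 / δ) ^ 2)) (𝓝[>] (0 : ℝ)) = 0 := by
  refine le_antisymm (ENNReal.le_of_forall_pos_le_add fun ε hε _ => ?_) zero_le
  rw [zero_add]
  have hε0 : (0 : ℝ) < ε := by exact_mod_cast hε
  refine limsup_le_of_le (by isBoundedDefault) ?_
  have hsq : Tendsto (fun δ : ℝ => (ε : ℝ) * Real.log (1 / δ) ^ 2) (𝓝[>] 0) atTop :=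
    ((tendsto_pow_atTop two_ne_zero).comp tendsto_log_one_div).const_mul_atTop hε0
  have hfloor : Tendsto (fun δ : ℝ => ⌊(ε : ℝ) * Real.log (1 / δ) ^ 2⌋₊) (𝓝[>] 0) atTop :=
    tendsto_nat_floor_atTop.comp hsq
  -- The `2` in `K` pays for rounding: `y ≤ 2 ⌊y⌋` once `y ≥ 2`, applied to `y = ε log(1/δ)²`.
  have hev := (eventually_beta_lt d (S := S) (K := √(2 / ε)) hS hc hL hk).and
    ((hZ.and hB).and (eventually_ge_atTop 1))
  filter_upwards [hfloor.eventually hev, hsq.eventually_ge_atTop 2,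
    tendsto_log_one_div.eventually_gt_atTop 0, self_mem_nhdsWithin,
    nhdsWithin_le_nhds (Iio_mem_nhds zero_lt_one)] with δ h1 h2 h3 hδ0 hδ1
  obtain ⟨hβ, ⟨hZt, hBt⟩, ht1⟩ := h1
  set ℓ := Real.log (1 / δ)
  set t := ⌊(ε : ℝ) * ℓ ^ 2⌋₊ with ht
  have hlow : (ε : ℝ) * ℓ ^ 2 ≤ 2 * t := by
    have := Nat.lt_floor_add_one ((ε : ℝ) * ℓ ^ 2)
    rw [← ht] at this
    linarith
  have hℓ : ℓ ≤ √(2 / ε) * √t := by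
    rw [← Real.sqrt_mul (by positivity)]
    refine Real.le_sqrt_of_sq_le ?_
    rw [div_mul_eq_mul_div, le_div_iff₀ hε0]
    linarith
  have htau : tau S L istar θstar (fun t => c * Real.log t) x θproj δ ≤ (t : ℕ∞) :=
    iInf₂_le t ⟨ht1, (hβ δ hδ0 hδ1 hℓ).trans_le hZt, hBt⟩
  have htau' : ((tau S L istar θstar (fun t => c * Real.log t) x θproj δ : ℕ∞) : ℝ≥0∞)
      ≤ (t : ℝ≥0∞) := by
    have := ENat.toENNReal_mono htau
    simpa using this
  refine ENNReal.div_le_of_le_mul (htau'.trans ?_)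
  rw [← ENNReal.ofReal_natCast, ← ENNReal.ofReal_coe_nnreal, ← ENNReal.ofReal_mul hε0.le]
  exact ENNReal.ofReal_le_ofReal (Nat.floor_le (by positivity))

end LogTS

/-! ### Conclusion: the almost sure bound -/

theorem mainTheorem2
    {d : ℕ} [NeZero d] {I : Type*} [Finite I]
    (𝒳 : Finset (LogTS.E d)) (S : ℝ) (hS : 0 < S)
    (hball : ∀ a ∈ 𝒳, ‖a‖ ≤ 1)
    (hspan : Submodule.span ℝ (𝒳 : Set (LogTS.E d)) = ⊤)
    (istar : LogTS.E d → I)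
    (θstar : LogTS.E d) (hθstar : θstar ∈ LogTS.Theta d S)
    (x0 : Fin d → 𝒳)
    (hx0 : 0 < LogTS.lambdaMin (∑ i, LogTS.outer (x0 i : LogTS.E d)))
    (c L : ℝ) (hc : 0 < c) (hL : 0 < L)
    {Ω : Type*} {mΩ : MeasurableSpace Ω} (P : Measure Ω) [IsProbabilityMeasure P]
    (ℱ : Filtration ℕ mΩ) (x : ℕ → Ω → 𝒳) (r : ℕ → Ω → ℝ)
    (hbandit : LogTS.IsLogisticBandit P ℱ 𝒳 θstar x r)
    (θhat θproj : ℕ → Ω → LogTS.E d) (w : ℕ → Ω → 𝒳 → ℝ)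
    (hrun : ∀ᵐ ω ∂P, LogTS.IsRun 𝒳 S istar x0 (fun t => x t ω) (fun t => r t ω)
      (fun t => θhat t ω) (fun t => θproj t ω) (fun t => w t ω)) :
    ∀ᵐ ω ∂P,
      limsup (fun δ : ℝ =>
          ((LogTS.tau S L istar θstar (fun t => c * Real.log t) (fun t => x t ω)
              (fun t => θproj t ω) δ : ℕ∞) : ℝ≥0∞)
            / ENNReal.ofReal (Real.log (1 / δ) ^ 2)) (𝓝[>] (0 : ℝ))
        ≤ LogTS.TStar 𝒳 S istar θstar := by
  filter_upwards [hrun, hbandit.ae_eventually_abs_noise_le] with ω hω hnoise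
  by_cases hpsi : LogTS.psiStar 𝒳 S istar θstar = 0
  · rw [LogTS.TStar, hpsi, ENNReal.inv_zero]
    exact le_top
  have hlim := hω.tendsto_proj hS hball hθstar hx0 LogTS.noiseRate_nonneg
    LogTS.tendsto_noiseRate hnoise
  obtain ⟨k, hk, hZ⟩ := hω.eventually_le_Z hball hθstar hx0 hlim hpsi
  rw [LogTS.limsup_tau_eq_zero hS hc hL hk hZ (hω.eventually_mem_B hx0 θstar c)]
  exact zero_le
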